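/- Let $S^1$ be the space of trace class operators on $\ell^2(\mathbb N)$, $\mathbb N=\{0,1,2,\dots\}$. For an infinite complex matrix $A=(A_{j,k})_{j,k\ge 0}$ write $\|A\|_{S^1}=\operatorname{Tr}|A|=\operatorname{Tr}\big((A^*A)^{1/2}\big)\in[0,\infty]$ if $A$ defines a bounded operator on $\ell^2(\mathbb N)$, and $\|A\|_{S^1}=\infty$ otherwise. For $r>0$ and $t\ge 0$ let $$H_{r,t}=\left(e^{-t(j+k)^r}-e^{-t(j+k+1)^r}\right)_{j,k\ge 0}.$$ (i) There is a universal constant $c>0$ such that for every $r>0$, with $\alpha=\frac{\min\{r,1\}}{2}$ and $f(x)=e^{-x^r}$, we have, for both choices of the sign, $$\|x^{\frac12\pm\alpha}f'\|_{L^2(0,\infty)}\le c\sqrt r,\qquad \|x^{\frac32\pm\alpha}f''\|_{L^2(0,\infty)}\le c(1+r)\sqrt r,$$ and $$\sup_{t\ge 0}\|H_{r,t}\|_{S^1}\le c(1+r).$$ (ii) The linear order in $r$ is optimal as $r\to\infty$: for every $r\ge 1$, with $n=\lfloor r\rfloor$ and $t=n^{-r}$, $$\|H_{r,t}\|_{S^1}\ge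 (n+1)\left(e^{-1}-e^{-(1+1/n)^r}\right),$$ and, as $r\to\infty$, $$(n+1)\left(e^{-1}-e^{-(1+1/n)^r}\right)\sim r\,(e^{-1}-e^{-e}).$$ In particular there is $c'>0$ such that $\sup_{t\ge 0}\|H_{r,t}\|_{S^1}\ge c' r$ for all sufficiently large $r$. -/

import Mathlib

open scoped ENNReal

noncomputable section

/-- The complex Hilbert space `ℓ²(ℕ)`. -/
abbrev EllTwo : Type := lp (fun _ : ℕ => ℂ) 2

/-- The standard basis vector `e_j` of `ℓ²(ℕ)`. -/
def stdVec (j : ℕ) : EllTwo := lp.single 2 j (1 : ℂ)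

/-- The bounded operator `T` on `ℓ²(ℕ)` is given by the infinite matrix `A`. -/
def HasMatrix (T : EllTwo →L[ℂ] EllTwo) (A : Matrix ℕ ℕ ℂ) : Prop :=
  ∀ j k : ℕ, inner ℂ (stdVec j) (T (stdVec k)) = A j k

/-- The absolute value `|T| = (T* T)^{1/2}` of a bounded operator on a complex Hilbert space. -/
def opAbs {H : Type*} [NormedAddCommGroup H] [InnerProductSpace ℂ H] [CompleteSpace H]
    (T : H →L[ℂ] H) : H →L[ℂ] H := CFC.abs T

/-- The trace norm `Tr |T| = ∑ᵢ ⟨|T| eᵢ, eᵢ⟩ ∈ [0, ∞]` of a bounded operator on `ℓ²(ℕ)`, where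
`|T| = (T* T)^{1/2}`. The operator is of trace class when this is finite. -/
def opTraceNorm (T : EllTwo →L[ℂ] EllTwo) : ℝ≥0∞ :=
  ∑' i : ℕ, ENNReal.ofReal (RCLike.re (inner ℂ (stdVec i) (opAbs T (stdVec i))))

/-- The `S¹` norm of an infinite matrix: the trace norm of the bounded operator on `ℓ²(ℕ)` that it
defines, and `∞` when there is no such operator. (There is at most one such operator, see
`HasMatrix.unique`, so that the infimum is over at most one value.) -/
def traceClassNorm (A : Matrix ℕ ℕ ℂ) : ℝ≥0∞ :=
  ⨅ (T : EllTwo →L[ℂ] EllTwo) (_ : HasMatrix T A), opTraceNorm T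

theorem inner_stdVec (j : ℕ) (x : EllTwo) : inner ℂ (stdVec j) x = x j := by
  simp [stdVec, lp.inner_single_left]

theorem HasMatrix.unique {T S : EllTwo →L[ℂ] EllTwo} {A : Matrix ℕ ℕ ℂ}
    (hT : HasMatrix T A) (hS : HasMatrix S A) : T = S := by
  have key : ∀ k, T (stdVec k) = S (stdVec k) := by
    intro k
    ext j
    rw [← inner_stdVec, ← inner_stdVec, hT j k, hS j k]
  ext1 x
  have hx := lp.hasSum_single (p := 2) (by norm_num) x
  have hs : ∀ k, (lp.single 2 k (x k) : EllTwo) = x k • stdVec k := by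
    intro k
    rw [stdVec, ← lp.single_smul]
    simp
  have h1 := hx.mapL T
  have h2 := hx.mapL S
  refine h1.unique ?_
  convert h2 using 2 with k
  rw [hs, map_smul, map_smul, key]

theorem HasMatrix.traceClassNorm_eq {T : EllTwo →L[ℂ] EllTwo} {A : Matrix ℕ ℕ ℂ}
    (hT : HasMatrix T A) : traceClassNorm A = opTraceNorm T := by
  refine le_antisymm (iInf₂_le T hT) (le_iInf₂ fun S hS => ?_)
  rw [hS.unique hT]

/-- The infinite Hankel matrix `(e^{-t(j+k)^r} - e^{-t(j+k+1)^r})_{j,k ≥ 0}`. -/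
def heatHankel (r t : ℝ) : Matrix ℕ ℕ ℂ := fun j k =>
  ((Real.exp (-t * ((j : ℝ) + k) ^ r) - Real.exp (-t * ((j : ℝ) + k + 1) ^ r) : ℝ) : ℂ)

end

/-! Upper bound. A product `A* B` satisfies Tr|A* B| ≤ (‖A‖² + ‖B‖²)/2 in Hilbert–Schmidt norms
(`opTraceNorm_adjoint_comp_le`). A Hankel matrix h(j+k) with h → 0 factors in this way: for 0 ≤ q ≤
1 the sum over l ≥ k of q^(l-k) (h(j+l) - q h(j+l+1)) telescopes to h(j+k), and a positive weight
ω_l can be inserted in one factor and removed from the other (`traceClassNorm_hankel_le`). It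
remains to choose q and ω so that both squared norms are O(1 + r) uniformly in t. For r ≤ 2, q = 1
works. For r ≥ 2 put t = s^r; the function e^{-(sx)^r} drops near x = 1/s over a length of order
1/(rs). If rs ≥ 1 this is at most of the order of the lattice spacing, and q = 0 suffices. If rs <
1, take q = 1 - rs, whose geometric kernel has the length 1/(rs). The sums are compared with
telescoping sums of bounded functions, chiefly functions of u = t x^r, which removes the dependence
on t. The L² estimates are independent of this: the squared integrands are dominated by multiples of
x^(r-1) e^{-x^r}, whose integral is 1/r. Lower bound. Pairing T with the flip of the first n+1 basis
vectors, a contraction, gives at most Tr|T|; on a Hankel matrix it adds n+1 equal entries. -/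

open scoped ENNReal

noncomputable section

/-! ### Trace norms and Hilbert–Schmidt norms on ℓ²(ℕ) -/

/-- Polar decomposition of a bounded operator, with a contraction `U`. -/
theorem exists_polar {H : Type*} [NormedAddCommGroup H] [InnerProductSpace ℂ H] [CompleteSpace H]
    (T : H →L[ℂ] H) : ∃ U : H →L[ℂ] H, (∀ x, ‖U x‖ ≤ ‖x‖) ∧ (∀ x, U (opAbs T x) = T x) ∧
      ∀ x, ContinuousLinearMap.adjoint U (T x) = opAbs T x := by
  have hS : IsSelfAdjoint (opAbs T) := (CFC.abs_nonneg T).isSelfAdjoint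
  have hin : ∀ x y, inner ℂ (opAbs T x) (opAbs T y) = inner ℂ (T x) (T y) := by
    intro x y
    rw [← ContinuousLinearMap.adjoint_inner_right, ← ContinuousLinearMap.star_eq_adjoint, hS.star_eq,
      ← mul_apply_eq_comp, opAbs, CFC.abs_mul_abs, mul_apply_eq_comp,
      ContinuousLinearMap.star_eq_adjoint, ContinuousLinearMap.adjoint_inner_right]
  have hnorm : ∀ x, ‖T x‖ = ‖opAbs T x‖ := by
    intro x
    rw [@norm_eq_sqrt_re_inner ℂ, @norm_eq_sqrt_re_inner ℂ, hin]
  -- On the closed range of |T| the map |T|x ↦ Tx is an isometry; composing its extension with the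
  -- projection onto that subspace makes it zero on the complement.
  let K : Submodule ℂ H := (LinearMap.range (opAbs T).toLinearMap).topologicalClosure
  have hmem : ∀ x, opAbs T x ∈ K := fun x =>
    Submodule.le_topologicalClosure _ (LinearMap.mem_range_self _ x)
  have : CompleteSpace K := (Submodule.isClosed_topologicalClosure _).completeSpace_coe
  let e : H →ₗ[ℂ] K := (opAbs T).toLinearMap.codRestrict K hmem
  have hdense : DenseRange e := by
    rw [denseRange_iff_closure_range, Set.eq_univ_iff_forall]
    rintro ⟨y, hy⟩
    rw [closure_subtype]
    have : y ∈ closure (Set.range (opAbs T)) := hy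
    convert! this using 2
    ext z
    constructor
    · rintro ⟨_, ⟨x, rfl⟩, rfl⟩
      exact ⟨x, rfl⟩
    · rintro ⟨x, rfl⟩
      exact ⟨e x, ⟨x, rfl⟩, rfl⟩
  have hb : ∀ x, ‖T.toLinearMap x‖ ≤ 1 * ‖e x‖ := fun x => by
    rw [one_mul]; exact (hnorm x).le
  let U₀ : K →L[ℂ] H := T.toLinearMap.extendOfNorm e
  have hU₀ : ∀ x, U₀ (e x) = T x := fun x => LinearMap.extendOfNorm_eq hdense ⟨1, hb⟩ x
  have hU₀n : ∀ z, ‖U₀ z‖ ≤ ‖z‖ := fun z => by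
    simpa using LinearMap.norm_extendOfNorm_apply_le hdense 1 hb z
  have hU₀i : ∀ x, ∀ z : K, inner ℂ (T x) (U₀ z) = inner ℂ (opAbs T x) (z : H) := by
    intro x z
    refine hdense.induction_on z (isClosed_eq (by fun_prop) (by fun_prop)) fun y => ?_
    rw [hU₀, ← hin]; rfl
  refine ⟨U₀ ∘L K.orthogonalProjectionOnto, fun x => ?_, fun x => ?_, fun x => ?_⟩
  · exact (hU₀n _).trans (K.norm_orthogonalProjectionOnto_apply_le x)
  · have : K.orthogonalProjectionOnto (opAbs T x) = e x :=
      K.orthogonalProjectionOnto_mem_subspace_eq_self (e x)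
    rw [ContinuousLinearMap.comp_apply, this, hU₀]
  · refine ext_inner_right ℂ fun y => ?_
    rw [ContinuousLinearMap.adjoint_inner_left, ContinuousLinearMap.comp_apply, hU₀i]
    exact K.inner_orthogonalProjectionOnto_eq_of_mem_left (e x) y

/-- The square root of the absolute value of a bounded operator. -/
theorem exists_sqrt_opAbs {H : Type*} [NormedAddCommGroup H] [InnerProductSpace ℂ H]
    [CompleteSpace H] (T : H →L[ℂ] H) : ∃ R : H →L[ℂ] H, ContinuousLinearMap.adjoint R = R ∧
      ∀ x, R (R x) = opAbs T x :=
  ⟨CFC.sqrt (opAbs T), (CFC.sqrt_nonneg (opAbs T)).isSelfAdjoint.star_eq, fun x => by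
    rw [← mul_apply_eq_comp,
      CFC.sqrt_mul_sqrt_self _ (show 0 ≤ opAbs T from CFC.abs_nonneg T)]⟩

/-- The square of the Hilbert–Schmidt norm. -/
def hsSq (T : EllTwo →L[ℂ] EllTwo) : ℝ≥0∞ := ∑' i : ℕ, ENNReal.ofReal (‖T (stdVec i)‖ ^ 2)

theorem ofReal_norm_sq_eq_tsum (x : EllTwo) :
    ENNReal.ofReal (‖x‖ ^ 2) = ∑' i, ENNReal.ofReal (‖x i‖ ^ 2) := by
  have h := lp.hasSum_norm (p := 2) (by norm_num) x
  simp only [ENNReal.toReal_ofNat, Real.rpow_ofNat] at h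
  rw [← h.tsum_eq, ENNReal.ofReal_tsum_of_nonneg (fun _ => by positivity) h.summable]

theorem hsSq_adjoint (T : EllTwo →L[ℂ] EllTwo) : hsSq (ContinuousLinearMap.adjoint T) = hsSq T := by
  simp only [hsSq, ofReal_norm_sq_eq_tsum]
  rw [ENNReal.tsum_comm]
  refine tsum_congr fun i => tsum_congr fun j => ?_
  rw [← inner_stdVec, ← inner_stdVec, ContinuousLinearMap.adjoint_inner_right, ← inner_conj_symm,
    RCLike.norm_conj]

theorem hsSq_comp_le (U T : EllTwo →L[ℂ] EllTwo) (hU : ∀ x, ‖U x‖ ≤ ‖x‖) :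
    hsSq (U ∘L T) ≤ hsSq T :=
  ENNReal.tsum_le_tsum fun _ => ENNReal.ofReal_le_ofReal (by gcongr; exact hU _)

theorem norm_adjoint_apply_le {U : EllTwo →L[ℂ] EllTwo} (hU : ∀ x, ‖U x‖ ≤ ‖x‖) (x : EllTwo) :
    ‖ContinuousLinearMap.adjoint U x‖ ≤ ‖x‖ := by
  have h1 : ‖U‖ ≤ 1 := U.opNorm_le_bound zero_le_one (by simpa using hU)
  have h2 : ‖ContinuousLinearMap.adjoint U‖ ≤ 1 := by
    rwa [LinearIsometryEquiv.norm_map]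
  simpa using (ContinuousLinearMap.adjoint U).le_of_opNorm_le h2 x

theorem hsSq_comp_le' (T U : EllTwo →L[ℂ] EllTwo) (hU : ∀ x, ‖U x‖ ≤ ‖x‖) :
    hsSq (T ∘L U) ≤ hsSq T := by
  rw [← hsSq_adjoint, ContinuousLinearMap.adjoint_comp, ← hsSq_adjoint T]
  exact hsSq_comp_le _ _ (norm_adjoint_apply_le hU)

theorem re_inner_le_half_add {H : Type*} [NormedAddCommGroup H] [InnerProductSpace ℂ H] (x y : H) :
    RCLike.re (inner ℂ x y) ≤ (‖x‖ ^ 2 + ‖y‖ ^ 2) / 2 := by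
  have := re_inner_le_norm (𝕜 := ℂ) x y
  nlinarith [sq_nonneg (‖x‖ - ‖y‖)]

/-- With |A* B| = U* A* B from the polar decomposition, the trace is the sum of ⟨A U e_i, B e_i⟩.
The arithmetic-geometric mean inequality applies termwise, and the contraction U does not increase
the Hilbert–Schmidt norm of A. -/
theorem opTraceNorm_adjoint_comp_le (A B : EllTwo →L[ℂ] EllTwo) :
    opTraceNorm (ContinuousLinearMap.adjoint A ∘L B) ≤ (hsSq A + hsSq B) / 2 := by
  obtain ⟨U, hU, -, hUT⟩ := exists_polar (ContinuousLinearMap.adjoint A ∘L B)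
  have h1 : opTraceNorm (ContinuousLinearMap.adjoint A ∘L B) ≤ (hsSq (A ∘L U) + hsSq B) / 2 := by
    rw [opTraceNorm, hsSq, hsSq, ← ENNReal.tsum_add, div_eq_mul_inv, ← ENNReal.tsum_mul_right]
    refine ENNReal.tsum_le_tsum fun i => ?_
    rw [← hUT, ContinuousLinearMap.adjoint_inner_right, ContinuousLinearMap.comp_apply,
      ContinuousLinearMap.adjoint_inner_right, ← ENNReal.ofReal_add (by positivity) (by positivity),
      ← div_eq_mul_inv]
    refine (ENNReal.ofReal_le_ofReal (re_inner_le_half_add _ _)).trans_eq ?_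
    rw [ENNReal.ofReal_div_of_pos two_pos]
    simp
  refine h1.trans ?_
  gcongr
  exact hsSq_comp_le' _ _ hU

/-- Write T = U R R with R = |T|^{1/2}. Each term is ⟨R U* e_{n-j}, R e_j⟩, and both R U* and R have
squared Hilbert–Schmidt norm at most Tr|T|. -/
theorem sum_antidiagonal_le_opTraceNorm (T : EllTwo →L[ℂ] EllTwo) (n : ℕ) :
    ENNReal.ofReal (∑ j ∈ Finset.range (n + 1),
      RCLike.re (inner ℂ (stdVec (n - j)) (T (stdVec j)))) ≤ opTraceNorm T := by
  obtain ⟨U, hU, hUT, -⟩ := exists_polar T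
  obtain ⟨R, hR, hRR⟩ := exists_sqrt_opAbs T
  have hin : ∀ x y, inner ℂ x (R y) = inner ℂ (R x) y := fun x y => by
    rw [← ContinuousLinearMap.adjoint_inner_right, hR]
  have htr : hsSq R = opTraceNorm T := by
    refine tsum_congr fun i => ?_
    rw [← hRR, hin, inner_self_eq_norm_sq]
  let V := ContinuousLinearMap.adjoint U
  have h2 : hsSq (R ∘L V) ≤ opTraceNorm T := by
    rw [← htr]
    exact hsSq_comp_le' _ _ (norm_adjoint_apply_le hU)
  have h3 : ∑ j ∈ Finset.range (n + 1), RCLike.re (inner ℂ (stdVec (n - j)) (T (stdVec j))) ≤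
      (∑ j ∈ Finset.range (n + 1), ‖(R ∘L V) (stdVec j)‖ ^ 2 +
        ∑ j ∈ Finset.range (n + 1), ‖R (stdVec j)‖ ^ 2) / 2 := by
    rw [← Finset.sum_range_reflect (fun j => ‖(R ∘L V) (stdVec j)‖ ^ 2), ← Finset.sum_add_distrib,
      Finset.sum_div]
    refine Finset.sum_le_sum fun j _ => ?_
    rw [← hUT, ← ContinuousLinearMap.adjoint_inner_left, ← hRR, hin]
    exact re_inner_le_half_add _ _
  refine (ENNReal.ofReal_le_ofReal h3).trans ?_
  rw [ENNReal.ofReal_div_of_pos two_pos, ENNReal.ofReal_add (by positivity) (by positivity),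
    ENNReal.ofReal_sum_of_nonneg (fun _ _ => by positivity),
    ENNReal.ofReal_sum_of_nonneg (fun _ _ => by positivity)]
  calc _ ≤ (hsSq (R ∘L V) + hsSq R) / ENNReal.ofReal 2 := by
        gcongr
        · exact ENNReal.sum_le_tsum _
        · exact ENNReal.sum_le_tsum _
    _ ≤ (opTraceNorm T + opTraceNorm T) / ENNReal.ofReal 2 := by
        rw [htr]
        gcongr
    _ = opTraceNorm T := by
        rw [← two_mul, ENNReal.ofReal_ofNat, mul_div_assoc]
        exact ENNReal.mul_div_cancel (by norm_num) (by norm_num)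

theorem sum_antidiagonal_le_traceClassNorm (A : Matrix ℕ ℕ ℂ) (n : ℕ) :
    ENNReal.ofReal (∑ j ∈ Finset.range (n + 1), (A (n - j) j).re) ≤ traceClassNorm A := by
  refine le_iInf₂ fun T hT => ?_
  have h := sum_antidiagonal_le_opTraceNorm T n
  simp only [hT _ _] at h
  exact h

theorem exists_clm_apply_stdVec (b : ℕ → EllTwo) (hb : Summable fun k => ‖b k‖ ^ 2) :
    ∃ B : EllTwo →L[ℂ] EllTwo, ∀ k, B (stdVec k) = b k := by
  have hle : ∀ (y : EllTwo) k, ‖inner ℂ (b k) y‖ ^ 2 ≤ ‖b k‖ ^ 2 * ‖y‖ ^ 2 := fun y k => by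
    rw [← mul_pow]
    gcongr
    exact norm_inner_le_norm _ _
  have hs : ∀ y : EllTwo, Summable fun k => ‖inner ℂ (b k) y‖ ^ 2 := fun y =>
    Summable.of_nonneg_of_le (fun _ => by positivity) (hle y) (hb.mul_right _)
  let L : EllTwo →ₗ[ℂ] EllTwo :=
    { toFun := fun y => ⟨fun k => inner ℂ (b k) y, by
        refine memℓp_gen ?_
        simpa using hs y⟩
      map_add' := fun x y => by ext k; exact inner_add_right _ _ _
      map_smul' := fun c x => by ext k; exact inner_smul_right _ _ _ }
  -- The operator with columns `b k` is the adjoint of y ↦ (⟨b_k, y⟩)_k, which Cauchy–Schwarz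
  -- bounds.
  let C : EllTwo →L[ℂ] EllTwo := L.mkContinuous (√(∑' k, ‖b k‖ ^ 2)) fun y => by
    refine le_of_sq_le_sq ?_ (by positivity)
    rw [mul_pow, Real.sq_sqrt (tsum_nonneg fun _ => by positivity), ← tsum_mul_right]
    have h := lp.hasSum_norm (p := 2) (by norm_num) (L y)
    simp only [ENNReal.toReal_ofNat, Real.rpow_ofNat] at h
    rw [← h.tsum_eq]
    exact (hs y).tsum_le_tsum (hle y) (hb.mul_right _)
  refine ⟨ContinuousLinearMap.adjoint C, fun k => ?_⟩
  refine ext_inner_right ℂ fun y => ?_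
  rw [ContinuousLinearMap.adjoint_inner_left, inner_stdVec]
  rfl

/-- A matrix of inner products of two square summable families is of trace class. -/
theorem traceClassNorm_le_of_inner {A : Matrix ℕ ℕ ℂ} (a b : ℕ → EllTwo) {α β : ℝ}
    (hA : ∀ j k, A j k = inner ℂ (a j) (b k))
    (ha : HasSum (fun j => ‖a j‖ ^ 2) α) (hb : HasSum (fun k => ‖b k‖ ^ 2) β) :
    traceClassNorm A ≤ ENNReal.ofReal ((α + β) / 2) := by
  obtain ⟨S, hS⟩ := exists_clm_apply_stdVec a ha.summable
  obtain ⟨T, hT⟩ := exists_clm_apply_stdVec b hb.summable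
  have hM : HasMatrix (ContinuousLinearMap.adjoint S ∘L T) A := fun j k => by
    rw [ContinuousLinearMap.comp_apply, ContinuousLinearMap.adjoint_inner_right, hS, hT, hA]
  rw [hM.traceClassNorm_eq]
  refine (opTraceNorm_adjoint_comp_le S T).trans_eq ?_
  simp only [hsSq, hS, hT]
  rw [← ENNReal.ofReal_tsum_of_nonneg (fun _ => by positivity) ha.summable,
    ← ENNReal.ofReal_tsum_of_nonneg (fun _ => by positivity) hb.summable, ha.tsum_eq, hb.tsum_eq,
    ENNReal.ofReal_div_of_pos two_pos, ENNReal.ofReal_add (ha.nonneg fun _ => by positivity)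
      (hb.nonneg fun _ => by positivity), ENNReal.ofReal_ofNat]

/-! ### Factorization of Hankel matrices -/

theorem summable_of_sum_exhaustion_le {ι : Type*} {G : ι → ℝ} (hG : ∀ p, 0 ≤ G p)
    (E : ℕ → Finset ι) (hE : Monotone E) (hcov : ∀ p, ∃ M, p ∈ E M) {α : ℝ}
    (h : ∀ M, ∑ p ∈ E M, G p ≤ α) : Summable G ∧ ∑' p, G p ≤ α := by
  have key : ∀ s : Finset ι, ∑ p ∈ s, G p ≤ α := by
    intro s
    obtain ⟨M, hM⟩ : ∃ M, s ⊆ E M := by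
      choose f hf using hcov
      exact ⟨s.sup f, fun p hp => hE (Finset.le_sup hp) (hf p)⟩
    exact (Finset.sum_le_sum_of_subset_of_nonneg hM fun p _ _ => hG p).trans (h M)
  exact ⟨summable_of_sum_le hG key, Real.tsum_le_of_sum_le hG key⟩

/-- A product of two real Hilbert–Schmidt matrices is of trace class. -/
theorem traceClassNorm_le_of_mul {A : ℕ → ℕ → ℝ} (P Q : ℕ → ℕ → ℝ) {α β : ℝ}
    (hP : Summable fun p : ℕ × ℕ => P p.1 p.2 ^ 2) (hPα : ∑' p : ℕ × ℕ, P p.1 p.2 ^ 2 ≤ α)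
    (hQ : Summable fun p : ℕ × ℕ => Q p.1 p.2 ^ 2) (hQβ : ∑' p : ℕ × ℕ, Q p.1 p.2 ^ 2 ≤ β)
    (hA : ∀ j k, Filter.Tendsto (fun M => ∑ l ∈ Finset.range M, P j l * Q k l) Filter.atTop
      (nhds (A j k))) :
    traceClassNorm (fun j k => ((A j k : ℝ) : ℂ)) ≤ ENNReal.ofReal ((α + β) / 2) := by
  have mk : ∀ R : ℕ → ℕ → ℝ, (Summable fun p : ℕ × ℕ => R p.1 p.2 ^ 2) →
      ∃ v : ℕ → EllTwo, (∀ j l, v j l = (R j l : ℂ)) ∧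
        HasSum (fun j => ‖v j‖ ^ 2) (∑' p : ℕ × ℕ, R p.1 p.2 ^ 2) := by
    intro R hR
    let v : ℕ → EllTwo := fun j => ⟨fun l => (R j l : ℂ), by
      refine memℓp_gen ?_
      simpa using hR.prod_factor j⟩
    refine ⟨v, fun j l => rfl, ?_⟩
    refine hR.hasSum.prod_fiberwise fun j => ?_
    have h := lp.hasSum_norm (p := 2) (by norm_num) (v j)
    simpa [v] using h
  obtain ⟨a, ha, has⟩ := mk P hP
  obtain ⟨b, hb, hbs⟩ := mk Q hQ
  refine (traceClassNorm_le_of_inner a b (fun j k => ?_) has hbs).trans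
    (ENNReal.ofReal_le_ofReal (by linarith))
  have h1 := (lp.hasSum_inner (𝕜 := ℂ) (a j) (b k)).tendsto_sum_nat
  refine tendsto_nhds_unique ?_ h1
  have h2 := (Complex.continuous_ofReal.tendsto _).comp (hA j k)
  refine h2.congr fun M => ?_
  simp [ha, hb, mul_comm]

/-- A trace norm bound for a Hankel matrix, by deconvolution with the geometric kernel `q ^ m`
and weights `ω`. -/
theorem traceClassNorm_hankel_le (h ω : ℕ → ℝ) (q : ℝ) (hq0 : 0 ≤ q) (hq1 : q ≤ 1)
    (hh : Filter.Tendsto h Filter.atTop (nhds 0)) (hω : ∀ l, 0 < ω l) {α β : ℝ}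
    (hα : ∀ M, ∑ n ∈ Finset.range M,
      (h n - q * h (n + 1)) ^ 2 * ∑ l ∈ Finset.range (n + 1), ω l ≤ α)
    (hβ : ∀ M, ∑ l ∈ Finset.range M, (∑ m ∈ Finset.range (l + 1), (q ^ m) ^ 2) / ω l ≤ β) :
    traceClassNorm (fun j k => ((h (j + k) : ℝ) : ℂ)) ≤ ENNReal.ofReal ((α + β) / 2) := by
  -- The weight √ω_l cancels in the product P Qᵀ. The entries of P depend on j + l apart from the
  -- weight, so its squares are summed along antidiagonals; those of Q are summed over squares,
  -- column by column.
  let P : ℕ → ℕ → ℝ := fun j l => (h (j + l) - q * h (j + l + 1)) * √(ω l)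
  let Q : ℕ → ℕ → ℝ := fun k l => if k ≤ l then q ^ (l - k) / √(ω l) else 0
  have hdisj : ∀ M : ℕ, (Finset.range M : Set ℕ).PairwiseDisjoint
      (Finset.HasAntidiagonal.antidiagonal : ℕ → Finset (ℕ × ℕ)) := by
    intro M i _ j _ hij
    refine Finset.disjoint_left.2 fun p hp hp' => hij ?_
    rw [Finset.HasAntidiagonal.mem_antidiagonal] at hp hp'
    omega
  have hP := summable_of_sum_exhaustion_le (G := fun p : ℕ × ℕ => P p.1 p.2 ^ 2)
    (fun _ => sq_nonneg _)
    (fun M => (Finset.range M).disjiUnion Finset.HasAntidiagonal.antidiagonal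
      (hdisj M))
    (fun M N hMN p hp => by
      simp only [Finset.mem_disjiUnion, Finset.mem_range] at hp ⊢
      obtain ⟨a, ha, h⟩ := hp
      exact ⟨a, by omega, h⟩)
    (fun p => ⟨p.1 + p.2 + 1, by simp⟩) (α := α) (fun M => by
      rw [Finset.sum_disjiUnion]
      refine le_trans (Finset.sum_le_sum fun n _ => ?_) (hα M)
      rw [Finset.Nat.sum_antidiagonal_eq_sum_range_succ_mk,
        ← Finset.sum_range_reflect (fun l => ω l), Finset.mul_sum]
      refine Finset.sum_le_sum fun i hi => ?_
      have hi' : i ≤ n := by simpa [Nat.lt_succ_iff] using hi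
      simp only [P, mul_pow, Real.sq_sqrt (hω _).le, Nat.add_sub_cancel' hi', add_tsub_cancel_right,
        le_refl])
  have hQ := summable_of_sum_exhaustion_le (G := fun p : ℕ × ℕ => Q p.1 p.2 ^ 2)
    (fun _ => sq_nonneg _)
    (fun M => Finset.range M ×ˢ Finset.range M)
    (fun M N hMN p hp => by
      simp only [Finset.mem_product, Finset.mem_range] at hp ⊢
      omega)
    (fun p => ⟨p.1 + p.2 + 1, by simp⟩) (α := β) (fun M => by
      rw [Finset.sum_product_right]
      refine le_trans (Finset.sum_le_sum fun l hl => ?_) (hβ M)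
      have hl' : l < M := by simpa using hl
      have hsub : Finset.range (l + 1) ⊆ Finset.range M := Finset.range_subset_range.2 hl'
      rw [← Finset.sum_subset hsub fun k _ hk => by
        have : ¬ k ≤ l := by simpa [Nat.lt_succ_iff] using hk
        simp [Q, this], ← Finset.sum_range_reflect, Finset.sum_div]
      refine Finset.sum_le_sum fun i hi => ?_
      have hi' : i ≤ l := by simpa [Nat.lt_succ_iff] using hi
      simp [Q, div_pow, Real.sq_sqrt (hω _).le, Nat.sub_sub_self hi'])
  refine traceClassNorm_le_of_mul P Q hP.1 hP.2 hQ.1 hQ.2 fun j k => ?_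
  have hpart : ∀ M, k ≤ M → ∑ l ∈ Finset.range M, P j l * Q k l =
      h (j + k) - q ^ (M - k) * h (j + M) := by
    intro M hM
    induction M, hM using Nat.le_induction with
    | base =>
      rw [Finset.sum_eq_zero]
      · simp
      · intro l hl
        have : ¬ k ≤ l := by simpa using hl
        simp [Q, this]
    | succ M hM ih =>
      have hne : √(ω M) ≠ 0 := (Real.sqrt_pos.2 (hω M)).ne'
      rw [Finset.sum_range_succ, ih]
      simp only [P, Q, hM, if_true, Nat.succ_sub hM, pow_succ, Nat.succ_eq_add_one, add_assoc]
      field_simp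
      ring
  have hlim : Filter.Tendsto (fun M => h (j + k) - q ^ (M - k) * h (j + M)) Filter.atTop
      (nhds (h (j + k))) := by
    have h0 : Filter.Tendsto (fun M => q ^ (M - k) * h (j + M)) Filter.atTop (nhds 0) := by
      have h1 : Filter.Tendsto (fun M => h (j + M)) Filter.atTop (nhds 0) := by
        simpa only [add_comm j] using (Filter.tendsto_add_atTop_iff_nat j).2 hh
      refine squeeze_zero_norm (fun M => ?_) (by simpa using h1.norm)
      rw [norm_mul, Real.norm_of_nonneg (by positivity)]
      exact mul_le_of_le_one_left (norm_nonneg _) (pow_le_one₀ hq0 hq1)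
    simpa using h0.const_sub (h (j + k))
  exact hlim.congr' (Filter.eventually_atTop.2 ⟨k, fun M hM => (hpart M hM).symm⟩)

/-! ### Derivatives and second differences of e^{-t x^r} -/

theorem hasDerivAt_mul_rpow (r t : ℝ) {x : ℝ} (hx : 0 < x) :
    HasDerivAt (fun x : ℝ => t * x ^ r) (r * (t * x ^ r) / x) x := by
  convert! (Real.hasDerivAt_rpow_const (p := r) (Or.inl hx.ne')).const_mul t using 1
  rw [Real.rpow_sub_one hx.ne']
  ring

theorem hasDerivAt_exp_neg_mul_rpow (r t : ℝ) {x : ℝ} (hx : 0 < x) :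
    HasDerivAt (fun x : ℝ => Real.exp (-(t * x ^ r)))
      (-(r * (t * x ^ r) / x * Real.exp (-(t * x ^ r)))) x := by
  convert! (hasDerivAt_mul_rpow r t hx).neg.exp using 1
  simp only [Pi.neg_apply]
  ring

theorem hasDerivAt_deriv_exp_neg_mul_rpow (r t : ℝ) {x : ℝ} (hx : 0 < x) :
    HasDerivAt (fun x : ℝ => -(r * (t * x ^ r) / x * Real.exp (-(t * x ^ r))))
      (r / x ^ 2 * (r * (t * x ^ r) ^ 2 - (r - 1) * (t * x ^ r)) * Real.exp (-(t * x ^ r))) x := by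
  convert! ((((hasDerivAt_mul_rpow r t hx).const_mul r).div (hasDerivAt_id x) hx.ne').mul
    (hasDerivAt_exp_neg_mul_rpow r t hx)).neg using 1
  simp only [id, Pi.div_apply]
  field_simp
  ring

theorem abs_second_deriv_le {r t x : ℝ} (hr : 0 < r) (ht : 0 ≤ t) (hx : 0 < x) :
    |r / x ^ 2 * (r * (t * x ^ r) ^ 2 - (r - 1) * (t * x ^ r)) * Real.exp (-(t * x ^ r))| ≤
      r * (1 + r) / x ^ 2 * (t * x ^ r * (1 + t * x ^ r)) * Real.exp (-(t * x ^ r)) := by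
  have hu : 0 ≤ t * x ^ r := by positivity
  set u := t * x ^ r
  rw [abs_mul, abs_mul, abs_of_pos (Real.exp_pos _), abs_of_pos (by positivity), mul_div_right_comm,
    mul_assoc (r / x ^ 2) (1 + r)]
  refine mul_le_mul_of_nonneg_right (mul_le_mul_of_nonneg_left ?_ (by positivity))
    (Real.exp_pos _).le
  rw [abs_le]
  constructor <;> nlinarith [mul_nonneg hr.le hu, sq_nonneg u]

/-- By the mean value theorem the second difference is f'(z) - f'(y) with a < y < z < a + 2. Both G
+ f' and G - f' increase on [y, z], and G increases on the whole interval. No derivative is needed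
at the endpoints, where x^r may be singular. -/
theorem abs_second_difference_le {f f' f'' G G' : ℝ → ℝ} {a : ℝ}
    (hf : ContinuousOn f (Set.Icc a (a + 2)))
    (hf' : ∀ x ∈ Set.Ioo a (a + 2), HasDerivAt f (f' x) x)
    (hf'' : ∀ x ∈ Set.Ioo a (a + 2), HasDerivAt f' (f'' x) x)
    (hG : ContinuousOn G (Set.Icc a (a + 2)))
    (hG' : ∀ x ∈ Set.Ioo a (a + 2), HasDerivAt G (G' x) x)
    (hle : ∀ x ∈ Set.Ioo a (a + 2), |f'' x| ≤ G' x) :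
    |f a - f (a + 1) - (f (a + 1) - f (a + 2))| ≤ G (a + 2) - G a := by
  obtain ⟨y, hy, hy'⟩ := exists_hasDerivAt_eq_slope f f' (show a < a + 1 by linarith)
    (hf.mono (Set.Icc_subset_Icc_right (by linarith)))
    fun x hx => hf' x ⟨hx.1, by linarith [hx.2]⟩
  obtain ⟨z, hz, hz'⟩ := exists_hasDerivAt_eq_slope f f' (show a + 1 < a + 2 by linarith)
    (hf.mono (Set.Icc_subset_Icc_left (by linarith)))
    fun x hx => hf' x ⟨by linarith [hx.1], hx.2⟩
  have hyz : y ≤ z := by linarith [hy.2, hz.1]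
  have hmono : ∀ (F F' : ℝ → ℝ) (b c : ℝ), b ≤ c → a ≤ b → c ≤ a + 2 →
      ContinuousOn F (Set.Icc b c) → (∀ x ∈ Set.Ioo a (a + 2), HasDerivAt F (F' x) x) →
      (∀ x ∈ Set.Ioo a (a + 2), 0 ≤ F' x) → F b ≤ F c := by
    intro F F' b c hbc hab hca hFc hF hF'
    refine monotoneOn_of_hasDerivWithinAt_nonneg (convex_Icc b c) hFc (f' := F') (fun x hx => ?_)
      (fun x hx => ?_) (Set.left_mem_Icc.2 hbc) (Set.right_mem_Icc.2 hbc) hbc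
    all_goals
      rw [interior_Icc] at hx
      have hx' : x ∈ Set.Ioo a (a + 2) := ⟨hab.trans_lt hx.1, hx.2.trans_le hca⟩
    · exact (hF x hx').hasDerivWithinAt
    · exact hF' x hx'
  have hcont : ContinuousOn f' (Set.Icc y z) := fun x hx =>
    (hf'' x ⟨hy.1.trans_le hx.1, hx.2.trans_lt hz.2⟩).continuousAt.continuousWithinAt
  have hGyz : ContinuousOn G (Set.Icc y z) := hG.mono (Set.Icc_subset_Icc hy.1.le hz.2.le)
  have hG0 : ∀ x ∈ Set.Ioo a (a + 2), 0 ≤ G' x := fun x hx => (abs_nonneg _).trans (hle x hx)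
  have h1 := hmono G G' a y hy.1.le le_rfl (by linarith [hy.2])
    (hG.mono (Set.Icc_subset_Icc_right (by linarith [hy.2]))) hG' hG0
  have h2 := hmono G G' z (a + 2) hz.2.le (by linarith [hz.1]) le_rfl
    (hG.mono (Set.Icc_subset_Icc_left (by linarith [hz.1]))) hG' hG0
  have h3 := hmono _ _ y z hyz hy.1.le hz.2.le (hGyz.add hcont)
    (fun x hx => (hG' x hx).add (hf'' x hx)) fun x hx => by linarith [(abs_le.1 (hle x hx)).1]
  have h4 := hmono _ _ y z hyz hy.1.le hz.2.le (hGyz.sub hcont)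
    (fun x hx => (hG' x hx).sub (hf'' x hx)) fun x hx => by linarith [(abs_le.1 (hle x hx)).2]
  simp only [Pi.add_apply, Pi.sub_apply] at h3 h4
  have e1 : f a - f (a + 1) = -f' y := by rw [hy']; ring
  have e2 : f (a + 1) - f (a + 2) = -f' z := by rw [hz']; ring
  rw [e1, e2, abs_le]
  constructor <;> linarith

theorem continuous_exp_neg_mul_rpow {r : ℝ} (hr : 0 < r) (t : ℝ) :
    Continuous fun x : ℝ => Real.exp (-(t * x ^ r)) := by
  have := Real.continuous_rpow_const (q := r) hr.le
  fun_prop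

theorem exp_second_difference_le {r t a : ℝ} (hr : 0 < r) (ht : 0 ≤ t) (ha : 0 ≤ a) {G G' : ℝ → ℝ}
    (hG : ContinuousOn G (Set.Icc a (a + 2)))
    (hG' : ∀ x ∈ Set.Ioo a (a + 2), HasDerivAt G (G' x) x)
    (hle : ∀ x ∈ Set.Ioo a (a + 2), r * (1 + r) / x ^ 2 * (t * x ^ r * (1 + t * x ^ r)) *
      Real.exp (-(t * x ^ r)) ≤ G' x) :
    |Real.exp (-(t * a ^ r)) - Real.exp (-(t * (a + 1) ^ r)) -
      (Real.exp (-(t * (a + 1) ^ r)) - Real.exp (-(t * (a + 2) ^ r)))| ≤ G (a + 2) - G a :=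
  abs_second_difference_le (f := fun x : ℝ => Real.exp (-(t * x ^ r)))
    (continuous_exp_neg_mul_rpow hr t).continuousOn
    (fun _ hx => hasDerivAt_exp_neg_mul_rpow r t (ha.trans_lt hx.1))
    (fun _ hx => hasDerivAt_deriv_exp_neg_mul_rpow r t (ha.trans_lt hx.1)) hG hG'
    fun x hx => (abs_second_deriv_le hr ht (ha.trans_lt hx.1)).trans (hle x hx)

theorem one_add_pow_three_le {u : ℝ} (hu : 0 ≤ u) : (1 + u) ^ 3 * Real.exp (-u) ≤ 18 := by
  have h := Real.pow_div_factorial_le_exp (1 + u) (by linarith) 3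
  rw [Real.exp_add] at h
  have h1 : (1 + u) ^ 3 ≤ 18 * Real.exp u := by
    have h2 : ((Nat.factorial 3 : ℕ) : ℝ) = 6 := by norm_num [Nat.factorial]
    rw [h2] at h
    nlinarith [Real.exp_one_lt_d9, Real.exp_pos u]
  rw [Real.exp_neg]
  rwa [← div_eq_mul_inv, div_le_iff₀ (Real.exp_pos u)]

theorem one_add_pow_four_le {u : ℝ} (hu : 0 ≤ u) : (1 + u) ^ 4 * Real.exp (-u) ≤ 72 := by
  have h := Real.pow_div_factorial_le_exp (1 + u) (by linarith) 4
  rw [Real.exp_add] at h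
  have h1 : (1 + u) ^ 4 ≤ 72 * Real.exp u := by
    have h2 : ((Nat.factorial 4 : ℕ) : ℝ) = 24 := by norm_num [Nat.factorial]
    rw [h2] at h
    nlinarith [Real.exp_one_lt_d9, Real.exp_pos u]
  rw [Real.exp_neg]
  rwa [← div_eq_mul_inv, div_le_iff₀ (Real.exp_pos u)]

theorem sum_range_le_of_telescope {b g : ℕ → ℝ} {c K : ℝ} (hb : ∀ n, 0 ≤ b n)
    (h : ∀ n, b (n + 1) ≤ g (n + 1) - g n) (h0 : b 0 ≤ c) (hg : ∀ n, g n - g 0 ≤ K) (M : ℕ) :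
    ∑ n ∈ Finset.range M, b n ≤ c + K := by
  calc _ ≤ ∑ n ∈ Finset.range (M + 1), b n := by
        rw [Finset.sum_range_succ]; linarith [hb M]
    _ = ∑ n ∈ Finset.range M, b (n + 1) + b 0 := Finset.sum_range_succ' _ _
    _ ≤ ∑ n ∈ Finset.range M, (g (n + 1) - g n) + c :=
        add_le_add (Finset.sum_le_sum fun n _ => h n) h0
    _ ≤ c + K := by rw [Finset.sum_range_sub]; linarith [hg M]

/-! ### The matrix entries, and the regime r ≤ 2 -/

/-- The entries of the Hankel matrix `heatHankel r t`. -/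
def heatDiff (r t : ℝ) (n : ℕ) : ℝ :=
  Real.exp (-(t * (n : ℝ) ^ r)) - Real.exp (-(t * ((n : ℝ) + 1) ^ r))

theorem heatHankel_eq (r t : ℝ) :
    heatHankel r t = fun j k => ((heatDiff r t (j + k) : ℝ) : ℂ) := by
  ext j k
  simp [heatHankel, heatDiff]

theorem heatDiff_nonneg {r t : ℝ} (hr : 0 < r) (ht : 0 ≤ t) (n : ℕ) : 0 ≤ heatDiff r t n := by
  rw [heatDiff, sub_nonneg, Real.exp_le_exp, neg_le_neg_iff]
  gcongr
  linarith

theorem heatDiff_le_one {r t : ℝ} (ht : 0 ≤ t) (n : ℕ) : heatDiff r t n ≤ 1 := by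
  have h1 : Real.exp (-(t * (n : ℝ) ^ r)) ≤ 1 := by
    rw [Real.exp_le_one_iff, neg_nonpos]
    positivity
  have h2 := Real.exp_pos (-(t * ((n : ℝ) + 1) ^ r))
  rw [heatDiff]
  linarith

theorem tendsto_heatDiff {r t : ℝ} (hr : 0 < r) (ht : 0 < t) :
    Filter.Tendsto (heatDiff r t) Filter.atTop (nhds 0) := by
  have h : Filter.Tendsto (fun n : ℕ => Real.exp (-(t * (n : ℝ) ^ r))) Filter.atTop (nhds 0) :=
    Real.tendsto_exp_neg_atTop_nhds_zero.comp
      (((tendsto_rpow_atTop hr).comp tendsto_natCast_atTop_atTop).const_mul_atTop ht)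
  have h1 := (Filter.tendsto_add_atTop_iff_nat 1).2 h
  have h2 := h.sub h1
  rw [sub_zero] at h2
  refine h2.congr fun n => ?_
  rw [heatDiff, Nat.cast_succ]

/-- A discrete form of d/dx [u/(1+u)] = r u / (x (1+u)²) for u = t x^r. Bernoulli's inequality is
used with exponent r/2 ≤ 1, which costs the factor 2. -/
theorem telescope_of_le_two {r t x : ℝ} (hr : 0 < r) (hr2 : r ≤ 2) (ht : 0 < t) (hx : 1 ≤ x) :
    t * x ^ r / (x * (1 + t * x ^ r) ^ 2) ≤
      2 / r * (t * x ^ r / (1 + t * x ^ r) - t * (x - 1) ^ r / (1 + t * (x - 1) ^ r)) := by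
  have hx0 : 0 < x := by linarith
  have hs0 : 0 ≤ 1 - 1 / x := by
    rw [sub_nonneg, div_le_one hx0]; exact hx
  have hs1 : 1 - 1 / x ≤ 1 := by
    have : 0 < 1 / x := by positivity
    linarith
  have h1 : (1 - 1 / x) ^ r ≤ 1 - r / 2 * (1 / x) := by
    calc (1 - 1 / x) ^ r ≤ (1 - 1 / x) ^ (r / 2) := by
          refine Real.rpow_le_rpow_of_exponent_ge' hs0 hs1 (by positivity) (by linarith)
      _ = (1 + -(1 / x)) ^ (r / 2) := by rw [sub_eq_add_neg]
      _ ≤ 1 + r / 2 * -(1 / x) :=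
          rpow_one_add_le_one_add_mul_self (by linarith) (by positivity) (by linarith)
      _ = _ := by ring
  have h2 : (x - 1) ^ r = x ^ r * (1 - 1 / x) ^ r := by
    rw [← Real.mul_rpow hx0.le hs0]
    congr 1
    field_simp
  set u := t * x ^ r with hu
  have hu0 : 0 < u := by positivity
  set v := t * (x - 1) ^ r with hv
  have hv0 : 0 ≤ v := by
    have : 0 ≤ x - 1 := by linarith
    positivity
  have h3 : r / 2 * (u / x) ≤ u - v := by
    have : v ≤ u * (1 - r / 2 * (1 / x)) := by
      rw [hv, h2, hu, ← mul_assoc]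
      gcongr
    calc r / 2 * (u / x) = u - u * (1 - r / 2 * (1 / x)) := by ring
      _ ≤ u - v := by linarith
  have hvu : v ≤ u := by
    have : 0 ≤ r / 2 * (u / x) := by positivity
    linarith
  calc u / (x * (1 + u) ^ 2) = 2 / r * (r / 2 * (u / x) / ((1 + u) * (1 + u))) := by
        field_simp
    _ ≤ 2 / r * ((u - v) / ((1 + u) * (1 + v))) := by
        gcongr
    _ = 2 / r * (u / (1 + u) - v / (1 + v)) := by
        congr 1
        field_simp
        ring

theorem heatDiff_sub_le_of_le_two {r t : ℝ} (hr : 0 < r) (hr2 : r ≤ 2) (ht : 0 < t) (n : ℕ)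
    (hn : 1 ≤ n) : |heatDiff r t n - heatDiff r t (n + 1)| ≤
      972 * r / (n : ℝ) ^ 2 * (t * (n : ℝ) ^ r / (1 + t * (n : ℝ) ^ r) ^ 2) := by
  have hn1 : (1 : ℝ) ≤ n := by exact_mod_cast hn
  have hn0 : (0 : ℝ) < n := by linarith
  set u := t * (n : ℝ) ^ r with hu
  have hu0 : 0 < u := by positivity
  -- On [n, n+2] ⊆ [n, 3n] the quantity t x^r lies between u and 9u, so a constant majorant of f''
  -- suffices. Here 486 = 3·9·18, from 1 + r ≤ 3, 3^r ≤ 9 and `one_add_pow_three_le`; the interval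
  -- length 2 gives 972.
  have h := exp_second_difference_le hr ht.le hn0.le
    (G := fun x => 486 * r / (n : ℝ) ^ 2 * (u / (1 + u) ^ 2) * x)
    (G' := fun x => 486 * r / (n : ℝ) ^ 2 * (u / (1 + u) ^ 2)) (by fun_prop)
    (fun x _ => by simpa using (hasDerivAt_id x).const_mul (486 * r / (n : ℝ) ^ 2 * (u / (1 + u) ^ 2)))
    (fun x hx => by
      have hx0 : 0 < x := hn0.trans hx.1
      have hw0 : 0 < t * x ^ r := by positivity
      have huw : u ≤ t * x ^ r := by
        rw [hu]; gcongr; exact hx.1.le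
      have hwu : t * x ^ r ≤ 9 * u := by
        calc t * x ^ r ≤ t * (3 * (n : ℝ)) ^ r := by
              gcongr; linarith [hx.2]
          _ = 3 ^ r * u := by rw [Real.mul_rpow (by norm_num) hn0.le, hu]; ring
          _ ≤ 9 * u := by
              gcongr
              calc (3 : ℝ) ^ r ≤ 3 ^ (2 : ℝ) := by gcongr; norm_num
                _ = 9 := by norm_num
      set w := t * x ^ r
      have hE : w * (1 + w) * Real.exp (-w) ≤ 162 * (u / (1 + u) ^ 2) := by
        calc w * (1 + w) * Real.exp (-w) = w / (1 + w) ^ 2 * ((1 + w) ^ 3 * Real.exp (-w)) := by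
              field_simp
          _ ≤ (9 * u) / (1 + u) ^ 2 * 18 := by
              gcongr
              exact one_add_pow_three_le hw0.le
          _ = _ := by ring
      calc r * (1 + r) / x ^ 2 * (w * (1 + w)) * Real.exp (-w)
          = r * (1 + r) / x ^ 2 * (w * (1 + w) * Real.exp (-w)) := by ring
        _ ≤ r * 3 / (n : ℝ) ^ 2 * (162 * (u / (1 + u) ^ 2)) := by
            gcongr
            · linarith
            · exact hx.1.le
        _ = _ := by ring)
  rw [heatDiff, heatDiff]
  push_cast
  rw [show (n : ℝ) + 1 + 1 = n + 2 by ring]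
  refine h.trans_eq ?_
  ring

/-- A uniform trace norm bound for `r ≤ 2`. -/
theorem exists_traceClassNorm_le_of_le_two : ∃ C : ℝ, 0 < C ∧ ∀ r t : ℝ, 0 < r → r ≤ 2 → 0 < t →
    traceClassNorm (heatHankel r t) ≤ ENNReal.ofReal C := by
  refine ⟨((4 + 4 * 972 ^ 2) + 9) / 2, by norm_num, fun r t hr hr2 ht => ?_⟩
  rw [heatHankel_eq]
  let u : ℕ → ℝ := fun n => t * (n : ℝ) ^ r
  have hu0 : ∀ n, 0 < u (n + 1) := fun n => by
    have : (0 : ℝ) < (n + 1 : ℕ) := by positivity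
    positivity
  have hu0' : ∀ n, 0 ≤ u n := fun n => by positivity
  -- This weight balances the factors: up to constants, both sums then have terms r u / (x (1+u)²),
  -- the telescoping quantity, so both are O(1). The value at 0 is set apart because u may vanish
  -- there.
  let ω : ℕ → ℝ := fun l => if l = 0 then 1 else (l : ℝ) ^ 2 * (u l + 1 / u l) / r
  have hωs : ∀ l, ω (l + 1) = ((l + 1 : ℕ) : ℝ) ^ 2 * (u (l + 1) + 1 / u (l + 1)) / r := fun l => by
    simp [ω]
  have hω : ∀ l, 0 < ω l := by
    intro l
    rcases l with _ | l
    · simp [ω]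
    · rw [hωs]
      have := hu0 l
      have : (0 : ℝ) < (l + 1 : ℕ) := by positivity
      positivity
  have hsq : ∀ n, 2 ≤ u (n + 1) + 1 / u (n + 1) := fun n => by
    have := hu0 n
    rw [← sub_nonneg]
    have : u (n + 1) + 1 / u (n + 1) - 2 = (u (n + 1) - 1) ^ 2 / u (n + 1) := by
      field_simp
      ring
    rw [this]
    positivity
  have hW : ∀ n, ∑ l ∈ Finset.range (n + 1 + 1), ω l ≤
      2 / r * ((n + 1 : ℕ) : ℝ) ^ 3 * (u (n + 1) + 1 / u (n + 1)) := by
    intro n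
    have hx : (1 : ℝ) ≤ (n + 1 : ℕ) := by simp
    rw [Finset.sum_range_succ']
    have h1 : ∀ l ∈ Finset.range (n + 1), ω (l + 1) ≤
        ((n + 1 : ℕ) : ℝ) ^ 2 * (u (n + 1) + 1 / u (n + 1)) / r := by
      intro l hl
      have hl' : ((l + 1 : ℕ) : ℝ) ≤ (n + 1 : ℕ) := by
        have := Finset.mem_range.1 hl
        exact_mod_cast this
      have hl0 : (0 : ℝ) < (l + 1 : ℕ) := by positivity
      -- The part l²/u_l of the weight is l^(2-r)/t, nondecreasing precisely because r ≤ 2.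
      have hdiv : ∀ y : ℝ, 0 < y → y ^ 2 * (1 / (t * y ^ r)) = 1 / t * y ^ (2 - r) := fun y hy => by
        rw [Real.rpow_sub hy]
        norm_num
        field_simp
      rw [hωs, mul_add, mul_add]
      gcongr ?_ / r
      refine add_le_add ?_ ?_
      · simp only [u]
        gcongr
      · simp only [u]
        rw [hdiv _ hl0, hdiv _ (by positivity)]
        gcongr
    have h2 := Finset.sum_le_card_nsmul _ _ _ h1
    rw [Finset.card_range, nsmul_eq_mul] at h2
    set x : ℝ := ((n + 1 : ℕ) : ℝ)
    set y := u (n + 1) + 1 / u (n + 1)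
    have hy : 2 ≤ y := hsq n
    have h3 : ω 0 ≤ x ^ 3 * y / r := by
      rw [le_div_iff₀ hr]
      simp only [ω, if_true, one_mul]
      have : 1 ≤ x ^ 3 := one_le_pow₀ hx
      nlinarith
    calc _ ≤ x * (x ^ 2 * y / r) + x ^ 3 * y / r := add_le_add h2 h3
      _ = _ := by ring
  have htel : ∀ n, u (n + 1) / (((n + 1 : ℕ) : ℝ) * (1 + u (n + 1)) ^ 2) ≤
      2 / r * (u (n + 1) / (1 + u (n + 1)) - u n / (1 + u n)) := fun n => by
    have h := telescope_of_le_two (x := ((n + 1 : ℕ) : ℝ)) hr hr2 ht (by simp)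
    rw [show ((n + 1 : ℕ) : ℝ) - 1 = n by push_cast; ring] at h
    exact h
  have hub : ∀ K : ℝ, 0 ≤ K → ∀ n, K * (u n / (1 + u n)) - K * (u 0 / (1 + u 0)) ≤ K := by
    intro K hK n
    have h1 : u n / (1 + u n) ≤ 1 := by
      rw [div_le_one (by linarith [hu0' n])]
      linarith
    have h2 : 0 ≤ u 0 / (1 + u 0) := by have := hu0' 0; positivity
    nlinarith
  refine traceClassNorm_hankel_le (heatDiff r t) ω 1 zero_le_one le_rfl (tendsto_heatDiff hr ht) hω
    (fun M => ?_) (fun M => ?_)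
  · refine sum_range_le_of_telescope (g := fun n => 4 * 972 ^ 2 * (u n / (1 + u n)))
      (fun n => mul_nonneg (sq_nonneg _) (Finset.sum_nonneg fun l _ => (hω l).le)) (fun n => ?_) ?_
      (hub _ (by norm_num)) M
    · have hd := heatDiff_sub_le_of_le_two hr hr2 ht (n + 1) (by omega)
      have ht' := htel n
      have hW' := hW n
      have hx : (0 : ℝ) < (n + 1 : ℕ) := by positivity
      have hu1 := hu0 n
      change |_| ≤ 972 * r / ((n + 1 : ℕ) : ℝ) ^ 2 * (u (n + 1) / (1 + u (n + 1)) ^ 2) at hd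
      set x : ℝ := ((n + 1 : ℕ) : ℝ)
      rw [one_mul]
      set d := heatDiff r t (n + 1) - heatDiff r t (n + 1 + 1)
      set w := u (n + 1)
      have hd2 : d ^ 2 ≤ (972 * r / x ^ 2 * (w / (1 + w) ^ 2)) ^ 2 := sq_le_sq.2 (by
        rwa [abs_of_nonneg (a := 972 * r / x ^ 2 * (w / (1 + w) ^ 2)) (by positivity)])
      calc _ ≤ (972 * r / x ^ 2 * (w / (1 + w) ^ 2)) ^ 2 * (2 / r * x ^ 3 * (w + 1 / w)) :=
            mul_le_mul hd2 hW' (Finset.sum_nonneg fun l _ => (hω l).le) (sq_nonneg _)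
        _ = 2 * 972 ^ 2 * r * (w / (x * (1 + w) ^ 2)) * ((1 + w ^ 2) / (1 + w) ^ 2) := by
            field_simp
            ring
        _ ≤ 2 * 972 ^ 2 * r * (2 / r * (w / (1 + w) - u n / (1 + u n))) * 1 := by
            refine mul_le_mul (by gcongr) ?_ (by positivity)
              (le_trans (by positivity) (mul_le_mul_of_nonneg_left ht' (by positivity)))
            rw [div_le_one (by positivity)]
            nlinarith
        _ = _ := by field_simp; ring
    · have h1 := heatDiff_nonneg hr ht.le 0
      have h2 := heatDiff_nonneg hr ht.le 1
      have h3 := heatDiff_le_one (r := r) ht.le 0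
      have h4 := heatDiff_le_one (r := r) ht.le 1
      simp only [zero_add, Finset.range_one, Finset.sum_singleton, ω, if_true, one_mul, mul_one]
      nlinarith
  · rw [show (9 : ℝ) = 1 + 8 by norm_num]
    refine sum_range_le_of_telescope (g := fun n => 8 * (u n / (1 + u n)))
      (fun n => div_nonneg (by positivity) (hω n).le) (fun n => ?_) ?_ (hub _ (by norm_num)) M
    · have ht' := htel n
      have hu1 := hu0 n
      have hx : (1 : ℝ) ≤ (n + 1 : ℕ) := by simp
      rw [hωs]
      simp only [one_pow, Finset.sum_const, Finset.card_range, nsmul_eq_mul, mul_one]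
      rw [Nat.cast_succ (n + 1)]
      set x : ℝ := ((n + 1 : ℕ) : ℝ)
      set w := u (n + 1)
      calc (x + 1) / (x ^ 2 * (w + 1 / w) / r) ≤ (2 * x) / (x ^ 2 * (w + 1 / w) / r) := by
            gcongr
            linarith
        _ = 2 * r * (w / (x * (1 + w ^ 2))) := by
            field_simp
            ring
        _ ≤ 2 * r * (2 * (w / (x * (1 + w) ^ 2))) := by
            gcongr
            rw [← mul_div_assoc, div_le_div_iff₀ (by positivity) (by positivity)]
            have : 0 ≤ w * x * (1 - w) ^ 2 := by positivity
            nlinarith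
        _ ≤ 2 * r * (2 * (2 / r * (w / (1 + w) - u n / (1 + u n)))) := by gcongr
        _ = _ := by field_simp; ring
    · simp [ω]

/-! ### The regime r ≥ 2 -/

theorem mul_exp_neg_le_one (u : ℝ) : u * Real.exp (-u) ≤ 1 := by
  rw [Real.exp_neg, ← div_eq_mul_inv, div_le_one (Real.exp_pos u)]
  linarith [Real.add_one_le_exp u]

theorem add_one_mul_heatDiff_le {r t : ℝ} (hr : 1 ≤ r) (ht : 0 ≤ t) (n : ℕ) :
    ((n : ℝ) + 1) * heatDiff r t n ≤ 2 * r := by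
  rcases n.eq_zero_or_pos with rfl | hn
  · have := heatDiff_le_one (r := r) ht 0
    push_cast
    linarith
  have hn1 : (1 : ℝ) ≤ n := by exact_mod_cast hn
  obtain ⟨y, hy, hy'⟩ := exists_hasDerivAt_eq_slope (fun x : ℝ => Real.exp (-(t * x ^ r))) _
    (show (n : ℝ) < n + 1 by linarith)
    (continuous_exp_neg_mul_rpow (by linarith) t).continuousOn
    fun x hx => hasDerivAt_exp_neg_mul_rpow r t (by linarith [hx.1])
  have hy0 : 0 < y := by linarith [hy.1]
  have h1 : heatDiff r t n = r / y * (t * y ^ r * Real.exp (-(t * y ^ r))) := by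
    have h2 : r * (t * y ^ r) / y * Real.exp (-(t * y ^ r)) =
      r / y * (t * y ^ r * Real.exp (-(t * y ^ r))) := by ring
    rw [heatDiff, ← h2, ← neg_inj, hy']
    ring
  calc ((n : ℝ) + 1) * heatDiff r t n
      ≤ (2 * y) * (r / y * 1) := by
        rw [h1]
        have := mul_exp_neg_le_one (t * y ^ r)
        gcongr
        linarith [hy.1]
    _ = 2 * r := by field_simp

/-- The right side is the integral of (1+w) e^{-w} from u = t n^r to v = t (n+1)^r; the inequality
reduces to 1 + (v-u) ≤ e^{v-u}. -/
theorem heatDiff_mul_le {r t : ℝ} (n : ℕ) :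
    heatDiff r t n * (1 + t * (n : ℝ) ^ r) ≤
      (2 + t * (n : ℝ) ^ r) * Real.exp (-(t * (n : ℝ) ^ r)) -
      (2 + t * ((n + 1 : ℕ) : ℝ) ^ r) * Real.exp (-(t * ((n + 1 : ℕ) : ℝ) ^ r)) := by
  rw [heatDiff]
  push_cast
  set u := t * (n : ℝ) ^ r
  set v := t * ((n : ℝ) + 1) ^ r
  have h : (1 + (v - u)) * Real.exp (-v) ≤ Real.exp (-u) := by
    calc (1 + (v - u)) * Real.exp (-v) ≤ Real.exp (v - u) * Real.exp (-v) := by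
          gcongr
          linarith [Real.add_one_le_exp (v - u)]
      _ = Real.exp (-u) := by rw [← Real.exp_add]; ring_nf
  linarith

theorem one_add_mul_sq_le {r s x : ℝ} (hr : 2 ≤ r) (hs : 0 ≤ s) (hx : 0 ≤ x) :
    (1 + s * x) ^ 2 ≤ 4 * (1 + s ^ r * x ^ r) := by
  rw [← Real.mul_rpow hs hx]
  have hv : 0 ≤ s * x := by positivity
  set v := s * x
  have h : v ^ 2 ≤ 1 + v ^ r := by
    rcases le_total v 1 with h1 | h1
    · have : 0 ≤ v ^ r := by positivity
      nlinarith
    · have : v ^ (2 : ℝ) ≤ v ^ r := Real.rpow_le_rpow_of_exponent_le h1 hr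
      rw [Real.rpow_two] at this
      linarith
  nlinarith [sq_nonneg (v - 1), Real.rpow_nonneg hv r]

/-- One factor h_n is spent on (n+1) h_n ≤ 2r; the other, with (1+sn)² ≤ 4(1+t n^r), telescopes to
at most 2. Hence 2·4·2 = 16. -/
theorem sum_heatDiff_sq_le {r s : ℝ} (hr : 2 ≤ r) (hs : 0 < s) (M : ℕ) :
    ∑ n ∈ Finset.range M, heatDiff r (s ^ r) n ^ 2 * (((n : ℝ) + 1) * (1 + s * n) ^ 2) ≤
      16 * r := by
  have ht : 0 ≤ s ^ r := by positivity
  set t := s ^ r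
  have hterm : ∀ n ∈ Finset.range M,
      heatDiff r t n ^ 2 * (((n : ℝ) + 1) * (1 + s * n) ^ 2) ≤
      8 * r * ((2 + t * (n : ℝ) ^ r) * Real.exp (-(t * (n : ℝ) ^ r))) -
      8 * r * ((2 + t * ((n + 1 : ℕ) : ℝ) ^ r) * Real.exp (-(t * ((n + 1 : ℕ) : ℝ) ^ r))) := by
    intro n _
    have h0 := heatDiff_nonneg (by linarith : 0 < r) ht n
    have h1 := add_one_mul_heatDiff_le (by linarith : 1 ≤ r) ht n
    have h2 := one_add_mul_sq_le hr hs.le n.cast_nonneg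
    calc heatDiff r t n ^ 2 * (((n : ℝ) + 1) * (1 + s * n) ^ 2)
        = (((n : ℝ) + 1) * heatDiff r t n) * heatDiff r t n * (1 + s * n) ^ 2 := by ring
      _ ≤ (2 * r) * heatDiff r t n * (4 * (1 + t * (n : ℝ) ^ r)) := by gcongr
      _ = 8 * r * (heatDiff r t n * (1 + t * (n : ℝ) ^ r)) := by ring
      _ ≤ 8 * r * _ := mul_le_mul_of_nonneg_left (heatDiff_mul_le n) (by linarith)
      _ = _ := by ring
  refine (Finset.sum_le_sum hterm).trans ?_
  rw [Finset.sum_range_sub']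
  have h1 : 0 ≤ 8 * r * ((2 + t * (M : ℝ) ^ r) * Real.exp (-(t * (M : ℝ) ^ r))) := by positivity
  have h2 : (2 + t * ((0 : ℕ) : ℝ) ^ r) * Real.exp (-(t * ((0 : ℕ) : ℝ) ^ r)) = 2 := by
    rw [Nat.cast_zero, Real.zero_rpow (by linarith)]
    simp
  rw [h2]
  linarith

theorem sum_weight_le {s : ℝ} (hs : 0 ≤ s) (n : ℕ) :
    ∑ l ∈ Finset.range (n + 1), (1 + s * (l : ℝ)) ^ 2 ≤ ((n : ℝ) + 1) * (1 + s * n) ^ 2 := by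
  have h : ∀ l ∈ Finset.range (n + 1), (1 + s * (l : ℝ)) ^ 2 ≤ (1 + s * n) ^ 2 := by
    intro l hl
    have : (l : ℝ) ≤ n := by
      have := Finset.mem_range.1 hl
      exact_mod_cast (by omega : l ≤ n)
    gcongr
  simpa using Finset.sum_le_card_nsmul _ _ _ h

theorem sum_inv_weight_le {s : ℝ} (hs : 0 < s) (M : ℕ) :
    ∑ l ∈ Finset.range M, 1 / (1 + s * (l : ℝ)) ^ 2 ≤ 1 + 1 / s := by
  refine sum_range_le_of_telescope (g := fun n => -(1 / s * (1 / (1 + s * (n : ℝ)))))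
    (fun n => by positivity) (fun n => ?_) (by simp) (fun n => ?_) M
  · have : -(1 / s * (1 / (1 + s * ((n + 1 : ℕ) : ℝ)))) - -(1 / s * (1 / (1 + s * (n : ℝ)))) =
        1 / ((1 + s * (n : ℝ)) * (1 + s * ((n + 1 : ℕ) : ℝ))) := by
      push_cast
      field_simp
      ring
    rw [this, sq]
    gcongr
    simp
  · have : 0 ≤ 1 / s * (1 / (1 + s * (n : ℝ))) := by positivity
    simp only [Nat.cast_zero, mul_zero, add_zero, div_one, mul_one]
    linarith

theorem traceClassNorm_le_of_one_le_mul {r s : ℝ} (hr : 2 ≤ r) (hs : 0 < s) (hrs : 1 ≤ r * s) :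
    traceClassNorm (heatHankel r (s ^ r)) ≤ ENNReal.ofReal ((16 * r + (1 + r)) / 2) := by
  rw [heatHankel_eq]
  refine traceClassNorm_hankel_le (heatDiff r (s ^ r)) (fun l => (1 + s * (l : ℝ)) ^ 2) 0 le_rfl
    zero_le_one (tendsto_heatDiff (by linarith) (by positivity)) (fun l => by positivity)
    (fun M => ?_) (fun M => ?_)
  · refine (Finset.sum_le_sum fun n _ => ?_).trans (sum_heatDiff_sq_le hr hs M)
    rw [zero_mul, sub_zero]
    exact mul_le_mul_of_nonneg_left (sum_weight_le hs.le n) (sq_nonneg _)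
  · have h1 : 1 / s ≤ r := by
      rw [div_le_iff₀ hs]; exact hrs
    refine le_trans (le_of_eq (Finset.sum_congr rfl fun l _ => ?_))
      ((sum_inv_weight_le hs M).trans (by linarith))
    congr 1
    -- For q = 0 only m = 0 survives, with 0^0 = 1.
    simp [← pow_mul, Finset.sum_range_succ']

theorem abs_heatDiff_sub_le {r s : ℝ} (hr : 2 ≤ r) (hs : 0 < s) (n : ℕ) :
    |heatDiff r (s ^ r) n - heatDiff r (s ^ r) (n + 1)| ≤ 72 * r ^ 2 * s ^ 2 := by
  have h := exp_second_difference_le (r := r) (t := s ^ r) (by linarith) (by positivity)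
    n.cast_nonneg (G := fun x => 36 * r ^ 2 * s ^ 2 * x) (G' := fun x => 36 * r ^ 2 * s ^ 2)
    (by fun_prop) (fun x _ => by simpa using (hasDerivAt_id x).const_mul (36 * r ^ 2 * s ^ 2))
    (fun x hx => by
      have hx0 : 0 < x := n.cast_nonneg.trans_lt hx.1
      have hv : 0 < s * x := by positivity
      rw [← Real.mul_rpow hs.le hx0.le]
      -- This is where r ≥ 2 keeps the second derivative bounded near 0.
      have h1 : (s * x) ^ r / (s * x) ^ 2 ≤ 1 + (s * x) ^ r := by
        rw [← Real.rpow_two, ← Real.rpow_sub hv]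
        rcases le_total (s * x) 1 with h1 | h1
        · have := Real.rpow_le_one hv.le h1 (by linarith : 0 ≤ r - 2)
          have : 0 ≤ (s * x) ^ r := by positivity
          linarith
        · have := Real.rpow_le_rpow_of_exponent_le h1 (by linarith : r - 2 ≤ r)
          linarith
      have hu : 0 ≤ (s * x) ^ r := by positivity
      have h18 := one_add_pow_three_le hu
      have hmono : (1 + (s * x) ^ r) ^ 2 * Real.exp (-(s * x) ^ r) ≤
          (1 + (s * x) ^ r) ^ 3 * Real.exp (-(s * x) ^ r) := by
        gcongr
        · linarith
        · norm_num
      set u := (s * x) ^ r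
      calc r * (1 + r) / x ^ 2 * (u * (1 + u)) * Real.exp (-u)
          = r * (1 + r) * s ^ 2 * (u / (s * x) ^ 2) * (1 + u) * Real.exp (-u) := by
            field_simp
        _ ≤ r * (r + r) * s ^ 2 * (1 + u) * (1 + u) * Real.exp (-u) := by
            gcongr
            linarith
        _ = 2 * r ^ 2 * s ^ 2 * ((1 + u) ^ 2 * Real.exp (-u)) := by ring
        _ ≤ 2 * r ^ 2 * s ^ 2 * 18 := by
            gcongr
            exact hmono.trans h18
        _ = _ := by ring)
  rw [heatDiff, heatDiff]
  push_cast
  rw [show (n : ℝ) + 1 + 1 = n + 2 by ring]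
  refine h.trans_eq ?_
  ring

/-- An antiderivative of `-(1 + u) ^ 2 * exp (-u)`. -/
def expTail (u : ℝ) : ℝ := (u ^ 2 + 4 * u + 5) * Real.exp (-u)

theorem hasDerivAt_expTail (u : ℝ) : HasDerivAt expTail (-((1 + u) ^ 2 * Real.exp (-u))) u := by
  have h := ((((hasDerivAt_id u).pow 2).add ((hasDerivAt_id u).const_mul 4)).add_const 5).mul
    (hasDerivAt_id u).neg.exp
  convert! h using 1
  simp only [id, Pi.add_apply, Pi.pow_apply, Pi.neg_apply]
  ring

theorem expTail_nonneg {u : ℝ} (hu : 0 ≤ u) : 0 ≤ expTail u := by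
  unfold expTail; positivity

theorem expTail_le {u : ℝ} (hu : 0 ≤ u) : expTail u ≤ 5 := by
  rw [expTail, Real.exp_neg, ← div_eq_mul_inv, div_le_iff₀ (Real.exp_pos u)]
  nlinarith [Real.quadratic_le_exp_of_nonneg hu]

theorem weight_mul_abs_heatDiff_sub_le {r s : ℝ} (hr : 2 ≤ r) (hs : 0 < s) (n : ℕ) (hn : 1 ≤ n) :
    ((n : ℝ) + 1) * (1 + s * n) ^ 2 * |heatDiff r (s ^ r) n - heatDiff r (s ^ r) (n + 1)| ≤
      16 * r * (expTail (s ^ r * (n : ℝ) ^ r) - expTail (s ^ r * ((n : ℝ) + 2) ^ r)) := by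
  have hn1 : (1 : ℝ) ≤ n := by exact_mod_cast hn
  have ht : 0 < s ^ r := by positivity
  set W := ((n : ℝ) + 1) * (1 + s * n) ^ 2 with hW
  have hW0 : 0 < W := by positivity
  have hcont : Continuous fun x : ℝ => -(16 * r / W) * expTail (s ^ r * x ^ r) := by
    have := Real.continuous_rpow_const (q := r) (by linarith)
    unfold expTail
    fun_prop
  have h := exp_second_difference_le (r := r) (t := s ^ r) (by linarith) ht.le
    n.cast_nonneg (G := fun x => -(16 * r / W) * expTail (s ^ r * x ^ r)) hcont.continuousOn
    (fun x hx => ((hasDerivAt_expTail _).comp x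
      (hasDerivAt_mul_rpow r (s ^ r) (n.cast_nonneg.trans_lt hx.1))).const_mul _)
    (fun x hx => by
      have hx0 : 0 < x := n.cast_nonneg.trans_lt hx.1
      have hWx : W ≤ (2 * x) * (4 * (1 + s ^ r * x ^ r)) := by
        calc W ≤ (2 * x) * (1 + s * x) ^ 2 := by
              rw [hW]
              gcongr
              · linarith [hx.1]
              · exact hx.1.le
          _ ≤ _ := by
              gcongr
              exact one_add_mul_sq_le hr hs.le hx0.le
      have hu : 0 < s ^ r * x ^ r := by positivity
      set u := s ^ r * x ^ r
      rw [← mul_le_mul_iff_right₀ hW0]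
      -- With u' = r u / x, the resulting majorant 16 r · (r u / x) (1+u)² e^{-u} is the derivative
      -- of -16 r `expTail` u.
      calc W * (r * (1 + r) / x ^ 2 * (u * (1 + u)) * Real.exp (-u))
          ≤ (2 * x) * (4 * (1 + u)) * (r * (r + r) / x ^ 2 * (u * (1 + u)) * Real.exp (-u)) := by
            gcongr
            linarith
        _ = _ := by field_simp; ring)
  rw [heatDiff, heatDiff]
  push_cast
  rw [show (n : ℝ) + 1 + 1 = n + 2 by ring]
  refine (mul_le_mul_of_nonneg_left h hW0.le).trans_eq ?_
  field_simp
  ring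

theorem sum_weight_mul_abs_heatDiff_sub_le {r s : ℝ} (hr : 2 ≤ r) (hs : 0 < s) (M : ℕ) :
    ∑ n ∈ Finset.range M, ((n : ℝ) + 1) * (1 + s * n) ^ 2 *
      |heatDiff r (s ^ r) n - heatDiff r (s ^ r) (n + 1)| ≤ 2 + 160 * r := by
  have ht : 0 < s ^ r := by positivity
  have hnn : ∀ n : ℕ, 0 ≤ s ^ r * (n : ℝ) ^ r := fun n => by positivity
  -- The intervals [n, n+2] overlap, so the telescoping function is a sum of two consecutive values;
  -- 160 = 16·2·5 from `expTail_le`, and 2 bounds the term n = 0.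
  refine sum_range_le_of_telescope (g := fun n => -(16 * r * (expTail (s ^ r * ((n + 1 : ℕ) : ℝ) ^ r)
    + expTail (s ^ r * ((n + 2 : ℕ) : ℝ) ^ r)))) (fun n => by positivity) (fun n => ?_) ?_
    (fun n => ?_) M
  · refine (weight_mul_abs_heatDiff_sub_le hr hs (n + 1) (by omega)).trans_eq ?_
    have : ((n + 1 : ℕ) : ℝ) + 2 = ((n + 1 + 2 : ℕ) : ℝ) := by push_cast; ring
    rw [this]
    ring_nf
  · have h1 := heatDiff_nonneg (by linarith : 0 < r) ht.le 0
    have h2 := heatDiff_nonneg (by linarith : 0 < r) ht.le 1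
    have h3 := heatDiff_le_one (r := r) ht.le 0
    have h4 := heatDiff_le_one (r := r) ht.le 1
    simp only [Nat.cast_zero, zero_add, mul_zero, add_zero, one_pow, mul_one, one_mul]
    rw [abs_le]
    constructor <;> linarith
  · have h1 := expTail_nonneg (hnn (n + 1))
    have h2 := expTail_nonneg (hnn (n + 2))
    have h3 := expTail_le (hnn (0 + 1))
    have h4 := expTail_le (hnn (0 + 2))
    nlinarith

theorem traceClassNorm_le_of_mul_lt_one {r s : ℝ} (hr : 2 ≤ r) (hs : 0 < s) (hrs : r * s < 1) :
    traceClassNorm (heatHankel r (s ^ r)) ≤ ENNReal.ofReal ((24000 * r + (1 + r)) / 2) := by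
  have hr0 : 0 < r := by linarith
  have hrs0 : 0 < r * s := by positivity
  rw [heatHankel_eq]
  refine traceClassNorm_hankel_le (heatDiff r (s ^ r))
    (fun l => 1 / (r * s) ^ 2 * (1 + s * (l : ℝ)) ^ 2) (1 - r * s) (by linarith) (by linarith)
    (tendsto_heatDiff hr0 (by positivity)) (fun l => by positivity) (fun M => ?_) (fun M => ?_)
  · set h := heatDiff r (s ^ r)
    let w : ℕ → ℝ := fun n => ((n : ℝ) + 1) * (1 + s * n) ^ 2
    have hw0 : ∀ n, 0 ≤ w n := fun n => by positivity
    have hw1 : ∀ n, w n ≤ w (n + 1) := fun n => by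
      simp only [w, Nat.cast_succ]
      gcongr <;> linarith
    have hterm : ∀ n ∈ Finset.range M,
        (h n - (1 - r * s) * h (n + 1)) ^ 2 *
          ∑ l ∈ Finset.range (n + 1), 1 / (r * s) ^ 2 * (1 + s * (l : ℝ)) ^ 2 ≤
        2 * (h (n + 1) ^ 2 * w (n + 1)) + 144 * (w n * |h n - h (n + 1)|) := by
      intro n _
      have hd := abs_heatDiff_sub_le hr hs n
      rw [← Finset.mul_sum]
      set d := h n - h (n + 1) with hd_def
      -- One factor |d| of d² is replaced by its uniform bound of order (rs)²; both terms then carry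
      -- the (rs)² that the weight cancels.
      have hsq : (h n - (1 - r * s) * h (n + 1)) ^ 2 ≤
          2 * (r * s) ^ 2 * h (n + 1) ^ 2 + 2 * ((72 * r ^ 2 * s ^ 2) * |d|) := by
        have e : h n - (1 - r * s) * h (n + 1) = r * s * h (n + 1) + d := by rw [hd_def]; ring
        have hd2 : d ^ 2 ≤ (72 * r ^ 2 * s ^ 2) * |d| := by
          rw [← sq_abs, sq]
          gcongr
        rw [e]
        nlinarith [sq_nonneg (r * s * h (n + 1) - d)]
      calc _ ≤ (2 * (r * s) ^ 2 * h (n + 1) ^ 2 + 2 * ((72 * r ^ 2 * s ^ 2) * |d|)) *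
            (1 / (r * s) ^ 2 * w n) := by
            gcongr
            exact sum_weight_le hs.le n
        _ = 2 * (h (n + 1) ^ 2 * w n) + 144 * (w n * |d|) := by
            field_simp
            ring
        _ ≤ _ := by
            gcongr
            exact hw1 n
    refine (Finset.sum_le_sum hterm).trans ?_
    rw [Finset.sum_add_distrib, ← Finset.mul_sum, ← Finset.mul_sum]
    have h1 : ∑ n ∈ Finset.range M, h (n + 1) ^ 2 * w (n + 1) ≤ 16 * r := by
      refine le_trans ?_ (sum_heatDiff_sq_le hr hs (M + 1))
      rw [Finset.sum_range_succ']
      exact le_add_of_nonneg_right (mul_nonneg (sq_nonneg _) (hw0 0))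
    have h2 := sum_weight_mul_abs_heatDiff_sub_le hr hs M
    linarith
  · have hterm : ∀ l ∈ Finset.range M,
        (∑ m ∈ Finset.range (l + 1), ((1 - r * s) ^ m) ^ 2) /
          (1 / (r * s) ^ 2 * (1 + s * (l : ℝ)) ^ 2) ≤ r * s * (1 / (1 + s * (l : ℝ)) ^ 2) := by
      intro l _
      have hg : ∑ m ∈ Finset.range (l + 1), ((1 - r * s) ^ m) ^ 2 ≤ 1 / (r * s) := by
        rw [le_div_iff₀ hrs0]
        have h1 := mul_neg_geom_sum (1 - r * s) (l + 1)
        have h2 : 0 ≤ (1 - r * s) ^ (l + 1) := pow_nonneg (by linarith) _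
        have h3 : ∑ m ∈ Finset.range (l + 1), ((1 - r * s) ^ m) ^ 2 ≤
            ∑ m ∈ Finset.range (l + 1), (1 - r * s) ^ m := by
          refine Finset.sum_le_sum fun m _ => ?_
          have h4 : 0 ≤ (1 - r * s) ^ m := pow_nonneg (by linarith) _
          have h5 : (1 - r * s) ^ m ≤ 1 := pow_le_one₀ (by linarith) (by linarith)
          nlinarith
        nlinarith
      calc _ ≤ 1 / (r * s) / (1 / (r * s) ^ 2 * (1 + s * (l : ℝ)) ^ 2) := by gcongr
        _ = _ := by field_simp
    refine (Finset.sum_le_sum hterm).trans ?_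
    rw [← Finset.mul_sum]
    calc r * s * _ ≤ r * s * (1 + 1 / s) := by
          gcongr
          exact sum_inv_weight_le hs M
      _ = r * s + r := by field_simp
      _ ≤ 1 + r := by linarith

/-! ### The bound uniform in t -/

theorem traceClassNorm_zero : traceClassNorm 0 = 0 := by
  have h : HasMatrix 0 0 := fun j k => by simp
  rw [h.traceClassNorm_eq]
  simp [opTraceNorm, opAbs]

theorem heatHankel_zero (r : ℝ) : heatHankel r 0 = 0 := by
  ext j k
  simp [heatHankel]

theorem exists_iSup_traceClassNorm_le : ∃ C : ℝ, 0 < C ∧ ∀ r : ℝ, 0 < r →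
    (⨆ (t : ℝ) (_ : 0 ≤ t), traceClassNorm (heatHankel r t)) ≤ ENNReal.ofReal (C * (1 + r)) := by
  obtain ⟨C, hC, h⟩ := exists_traceClassNorm_le_of_le_two
  refine ⟨C + 24000, by linarith, fun r hr => iSup₂_le fun t ht => ?_⟩
  rcases ht.eq_or_lt with rfl | ht
  · rw [heatHankel_zero, traceClassNorm_zero]
    exact zero_le
  rcases le_total r 2 with hr2 | hr2
  · refine (h r t hr hr2 ht).trans (ENNReal.ofReal_le_ofReal ?_)
    nlinarith
  · have hs : 0 < t ^ r⁻¹ := by positivity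
    have hts : (t ^ r⁻¹) ^ r = t := Real.rpow_inv_rpow ht.le hr.ne'
    rw [← hts]
    have hCr : 0 < C * r := by positivity
    rcases le_or_gt 1 (r * t ^ r⁻¹) with h1 | h1
    · refine (traceClassNorm_le_of_one_le_mul hr2 hs h1).trans (ENNReal.ofReal_le_ofReal ?_)
      nlinarith
    · refine (traceClassNorm_le_of_mul_lt_one hr2 hs h1).trans (ENNReal.ofReal_le_ofReal ?_)
      nlinarith

/-! ### The L² estimates -/

theorem eLpNorm_two_le_of_sq_le {r K : ℝ} (hr : 0 < r) (hK : 0 ≤ K) {g : ℝ → ℝ}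
    (hg : ∀ x, 0 < x → g x ^ 2 ≤ (K * r) ^ 2 * (x ^ (r - 1) * Real.exp (-x ^ r))) :
    MeasureTheory.eLpNorm g 2 (MeasureTheory.volume.restrict (Set.Ioi (0 : ℝ))) ≤
      ENNReal.ofReal (K * √r) := by
  have hval : ∫ x in Set.Ioi (0 : ℝ), x ^ (r - 1) * Real.exp (-x ^ r) = 1 / r := by
    rw [integral_rpow_mul_exp_neg_rpow hr (by linarith)]
    simp [hr.ne']
  have hint : MeasureTheory.Integrable (fun x : ℝ => x ^ (r - 1) * Real.exp (-x ^ r))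
      (MeasureTheory.volume.restrict (Set.Ioi (0 : ℝ))) := by
    -- A non-integrable function has integral 0 by convention, whereas this one has integral 1/r.
    refine not_not.1 fun h => ?_
    rw [MeasureTheory.integral_undef h] at hval
    exact (one_div_pos.2 hr).ne hval
  rw [MeasureTheory.eLpNorm_eq_lintegral_rpow_enorm_toReal (by norm_num) (by norm_num)]
  have h1 : ∫⁻ x in Set.Ioi (0 : ℝ), ‖g x‖ₑ ^ (2 : ℝ≥0∞).toReal ≤ ENNReal.ofReal ((K * √r) ^ 2) := by
    calc ∫⁻ x in Set.Ioi (0 : ℝ), ‖g x‖ₑ ^ (2 : ℝ≥0∞).toReal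
        ≤ ∫⁻ x in Set.Ioi (0 : ℝ),
          ENNReal.ofReal ((K * r) ^ 2 * (x ^ (r - 1) * Real.exp (-x ^ r))) := by
          refine MeasureTheory.setLIntegral_mono' measurableSet_Ioi fun x hx => ?_
          rw [ENNReal.toReal_ofNat, ENNReal.rpow_ofNat, Real.enorm_eq_ofReal_abs,
            ← ENNReal.ofReal_pow (abs_nonneg _), sq_abs]
          exact ENNReal.ofReal_le_ofReal (hg x hx)
      _ = ENNReal.ofReal ((K * √r) ^ 2) := by
          rw [← MeasureTheory.ofReal_integral_eq_lintegral_ofReal (hint.const_mul _),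
            MeasureTheory.integral_const_mul, hval, mul_pow K (√r), Real.sq_sqrt hr.le]
          · congr 1
            field_simp
          · refine (MeasureTheory.ae_restrict_iff' measurableSet_Ioi).2 (.of_forall fun x hx => ?_)
            have : (0 : ℝ) < x := hx
            simp only [Pi.zero_apply]
            positivity
  refine (ENNReal.rpow_le_rpow h1 (by norm_num)).trans_eq ?_
  rw [ENNReal.ofReal_rpow_of_nonneg (by positivity) (by norm_num), ENNReal.toReal_ofNat,
    ← Real.sqrt_eq_rpow, Real.sqrt_sq (by positivity)]

theorem deriv_exp_neg_rpow (r : ℝ) {x : ℝ} (hx : 0 < x) :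
    deriv (fun y : ℝ => Real.exp (-(y ^ r))) x = -(r * (1 * x ^ r) / x * Real.exp (-(1 * x ^ r))) := by
  simpa only [one_mul] using (hasDerivAt_exp_neg_mul_rpow r 1 hx).deriv

theorem deriv_deriv_exp_neg_rpow (r : ℝ) {x : ℝ} (hx : 0 < x) :
    deriv (deriv fun y : ℝ => Real.exp (-(y ^ r))) x =
      r / x ^ 2 * (r * (1 * x ^ r) ^ 2 - (r - 1) * (1 * x ^ r)) * Real.exp (-(1 * x ^ r)) := by
  refine Eq.trans (Filter.EventuallyEq.deriv_eq ?_) (hasDerivAt_deriv_exp_neg_mul_rpow r 1 hx).deriv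
  filter_upwards [lt_mem_nhds hx] with y hy using deriv_exp_neg_rpow r hy

/-- The exponent 2β + r lies in [0, 2r], so the power is at most 1 for x ≤ 1 and at most x^{2r} for
x ≥ 1. This is all that is needed of β = ±min(r,1)/2. -/
theorem rpow_mul_rpow_le {r β x : ℝ} (hx : 0 < x) (h0 : -r ≤ 2 * β) (h1 : 2 * β ≤ r) :
    x ^ (2 * β) * x ^ r ≤ 1 + (x ^ r) ^ 2 := by
  have h2 : (x ^ r) ^ 2 = x ^ (r * 2) := by
    rw [Real.rpow_mul hx.le, Real.rpow_two]
  rw [← Real.rpow_add hx, h2]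
  rcases le_total x 1 with h | h
  · have := Real.rpow_le_one hx.le h (by linarith : 0 ≤ 2 * β + r)
    have : 0 ≤ x ^ (r * 2) := by positivity
    linarith
  · have := Real.rpow_le_rpow_of_exponent_le h (by linarith : 2 * β + r ≤ r * 2)
    linarith

theorem rpow_natCast_div_two_add_sq {x : ℝ} (hx : 0 < x) (k : ℕ) (β : ℝ) :
    (x ^ ((k : ℝ) / 2 + β)) ^ 2 = x ^ k * x ^ (2 * β) := by
  rw [← Real.rpow_natCast x k, ← Real.rpow_add hx, ← Real.rpow_two, ← Real.rpow_mul hx.le]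
  ring_nf

theorem eLpNorm_deriv_exp_neg_rpow_le {r β : ℝ} (hr : 0 < r) (h0 : -r ≤ 2 * β) (h1 : 2 * β ≤ r) :
    MeasureTheory.eLpNorm
      (fun x : ℝ => x ^ (1 / 2 + β) * deriv (fun y : ℝ => Real.exp (-(y ^ r))) x) 2
      (MeasureTheory.volume.restrict (Set.Ioi (0 : ℝ))) ≤ ENNReal.ofReal (9 * √r) := by
  refine eLpNorm_two_le_of_sq_le hr (by norm_num) fun x hx => ?_
  have hw := rpow_natCast_div_two_add_sq hx 1 β
  rw [Nat.cast_one, pow_one] at hw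
  have hu : 0 < x ^ r := by positivity
  have hβ := rpow_mul_rpow_le hx h0 h1
  have h3 := one_add_pow_three_le hu.le
  rw [deriv_exp_neg_rpow r hx, mul_pow, hw, Real.rpow_sub_one hx.ne', one_mul]
  set u := x ^ r
  set b := x ^ (2 * β)
  have hE := Real.exp_pos (-u)
  set E := Real.exp (-u)
  calc x * b * (-(r * u / x * E)) ^ 2 = r ^ 2 * (u / x * E) * (b * u * E) := by
        field_simp
    _ ≤ r ^ 2 * (u / x * E) * 81 := by
        gcongr
        calc b * u * E ≤ (1 + u) ^ 3 * E := by
              gcongr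
              nlinarith [pow_pos hu 3]
          _ ≤ 81 := by linarith
    _ = _ := by ring

theorem eLpNorm_deriv_deriv_exp_neg_rpow_le {r β : ℝ} (hr : 0 < r) (h0 : -r ≤ 2 * β)
    (h1 : 2 * β ≤ r) : MeasureTheory.eLpNorm
      (fun x : ℝ => x ^ (3 / 2 + β) * deriv (deriv (fun y : ℝ => Real.exp (-(y ^ r)))) x) 2
      (MeasureTheory.volume.restrict (Set.Ioi (0 : ℝ))) ≤ ENNReal.ofReal (9 * (1 + r) * √r) := by
  refine eLpNorm_two_le_of_sq_le hr (by positivity) fun x hx => ?_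
  have hw := rpow_natCast_div_two_add_sq hx 3 β
  rw [Nat.cast_ofNat] at hw
  have hu : 0 < x ^ r := by positivity
  have hβ := rpow_mul_rpow_le hx h0 h1
  have h4 := one_add_pow_four_le hu.le
  have hd := abs_second_deriv_le (t := 1) hr zero_le_one hx
  rw [deriv_deriv_exp_neg_rpow r hx, mul_pow, hw, Real.rpow_sub_one hx.ne']
  rw [one_mul] at hd ⊢
  set u := x ^ r
  set b := x ^ (2 * β)
  have hb : 0 ≤ b := by positivity
  have hE := Real.exp_pos (-u)
  set E := Real.exp (-u)
  have hd2 := sq_le_sq.2 (hd.trans_eq (abs_of_nonneg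
    (by positivity : 0 ≤ r * (1 + r) / x ^ 2 * (u * (1 + u)) * E)).symm)
  calc _ ≤ x ^ 3 * b * (r * (1 + r) / x ^ 2 * (u * (1 + u)) * E) ^ 2 := by gcongr
    _ = r ^ 2 * (1 + r) ^ 2 * (u / x * E) * (b * u * (1 + u) ^ 2 * E) := by
        field_simp
    _ ≤ r ^ 2 * (1 + r) ^ 2 * (u / x * E) * 81 := by
        gcongr
        calc b * u * (1 + u) ^ 2 * E ≤ (1 + u) ^ 2 * (1 + u) ^ 2 * E := by
              gcongr
              nlinarith
          _ = (1 + u) ^ 4 * E := by ring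
          _ ≤ 81 := by linarith
    _ = _ := by ring

/-! ### The lower bound and its asymptotics -/

theorem le_traceClassNorm_heatHankel (r : ℝ) (n : ℕ) (hn : n ≠ 0) :
    ENNReal.ofReal (((n : ℝ) + 1) *
      (Real.exp (-1) - Real.exp (-((1 + 1 / (n : ℝ)) ^ r)))) ≤
      traceClassNorm (heatHankel r ((n : ℝ) ^ (-r))) := by
  have hn0 : (0 : ℝ) < n := by positivity
  refine le_trans (le_of_eq ?_) (sum_antidiagonal_le_traceClassNorm _ n)
  congr 1
  rw [Finset.sum_congr rfl (g := fun _ => Real.exp (-1) - Real.exp (-((1 + 1 / (n : ℝ)) ^ r)))]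
  · rw [Finset.sum_const, Finset.card_range, nsmul_eq_mul, Nat.cast_succ]
  · intro j hj
    have hjn : j ≤ n := by simpa [Nat.lt_succ_iff] using hj
    have h1 : ((n - j : ℕ) : ℝ) + j = n := by
      rw [Nat.cast_sub hjn]; ring
    have h2 : (n : ℝ) ^ (-r) * (n : ℝ) ^ r = 1 := by
      rw [← Real.rpow_add hn0]; simp
    have h3 : (n : ℝ) ^ (-r) * ((n : ℝ) + 1) ^ r = (1 + 1 / (n : ℝ)) ^ r := by
      rw [show (1 + 1 / (n : ℝ)) = ((n : ℝ) + 1) / n by field_simp,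
        Real.div_rpow (by positivity) hn0.le, Real.rpow_neg hn0.le]
      ring
    rw [heatHankel, Complex.ofReal_re, h1, neg_mul, neg_mul, h2, h3]

theorem tendsto_one_add_inv_floor_rpow :
    Filter.Tendsto (fun r : ℝ => (1 + 1 / (⌊r⌋₊ : ℝ)) ^ r) Filter.atTop (nhds (Real.exp 1)) := by
  have h1 : Filter.Tendsto (fun r : ℝ => (1 + 1 / (⌊r⌋₊ : ℝ)) ^ ⌊r⌋₊) Filter.atTop
      (nhds (Real.exp 1)) :=
    (Real.tendsto_one_add_div_pow_exp 1).comp tendsto_nat_floor_atTop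
  -- With n = ⌊r⌋, write (1+1/n)^r = ((1+1/n)^n)^{r/n}, where r/n → 1.
  have h2 : Filter.Tendsto (fun r : ℝ => r / (⌊r⌋₊ : ℝ)) Filter.atTop (nhds 1) := by
    simpa using (tendsto_nat_floor_div_atTop (R := ℝ)).inv₀ one_ne_zero
  have h3 := h1.rpow h2 (Or.inl (Real.exp_pos 1).ne')
  rw [Real.rpow_one] at h3
  refine h3.congr' ?_
  filter_upwards [Filter.eventually_ge_atTop 1] with r hr
  have hn : (⌊r⌋₊ : ℝ) ≠ 0 := by
    have := Nat.floor_pos.2 hr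
    positivity
  rw [← Real.rpow_natCast, ← Real.rpow_mul (by positivity)]
  congr 1
  field_simp

theorem exp_neg_one_sub_pos : 0 < Real.exp (-1) - Real.exp (-Real.exp 1) := by
  rw [sub_pos, Real.exp_lt_exp, neg_lt_neg_iff]
  exact Real.one_lt_exp_iff.2 one_pos

theorem isEquivalent_floor_mul : Asymptotics.IsEquivalent Filter.atTop
    (fun r : ℝ => ((⌊r⌋₊ : ℝ) + 1) *
      (Real.exp (-1) - Real.exp (-((1 + 1 / (⌊r⌋₊ : ℝ)) ^ r))))
    (fun r : ℝ => r * (Real.exp (-1) - Real.exp (-Real.exp 1))) := by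
  have h1 : Asymptotics.IsEquivalent Filter.atTop (fun r : ℝ => (⌊r⌋₊ : ℝ) + 1) fun r => r :=
    Asymptotics.isEquivalent_nat_floor.add_isLittleO
      (Asymptotics.isLittleO_const_id_atTop (1 : ℝ))
  refine h1.mul ?_
  refine (Asymptotics.isEquivalent_const_iff_tendsto exp_neg_one_sub_pos.ne').2 ?_
  exact ((Real.continuous_exp.tendsto _).comp tendsto_one_add_inv_floor_rpow.neg).const_sub _

end

theorem mainTheorem9 :
    (∃ c : ℝ, 0 < c ∧ ∀ r : ℝ, 0 < r →
      (∀ β : ℝ, (β = min r 1 / 2 ∨ β = -(min r 1 / 2)) →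
        MeasureTheory.eLpNorm
            (fun x : ℝ => x ^ (1 / 2 + β) * deriv (fun y : ℝ => Real.exp (-(y ^ r))) x) 2
            (MeasureTheory.volume.restrict (Set.Ioi (0 : ℝ)))
          ≤ ENNReal.ofReal (c * Real.sqrt r) ∧
        MeasureTheory.eLpNorm
            (fun x : ℝ => x ^ (3 / 2 + β) * deriv (deriv (fun y : ℝ => Real.exp (-(y ^ r)))) x) 2
            (MeasureTheory.volume.restrict (Set.Ioi (0 : ℝ)))
          ≤ ENNReal.ofReal (c * (1 + r) * Real.sqrt r)) ∧
      (⨆ (t : ℝ) (_ : 0 ≤ t), traceClassNorm (heatHankel r t)) ≤ ENNReal.ofReal (c * (1 + r))) ∧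
    (∀ r : ℝ, 1 ≤ r →
      ENNReal.ofReal (((⌊r⌋₊ : ℝ) + 1) *
          (Real.exp (-1) - Real.exp (-((1 + 1 / (⌊r⌋₊ : ℝ)) ^ r))))
        ≤ traceClassNorm (heatHankel r ((⌊r⌋₊ : ℝ) ^ (-r)))) ∧
    Asymptotics.IsEquivalent Filter.atTop
      (fun r : ℝ => ((⌊r⌋₊ : ℝ) + 1) *
          (Real.exp (-1) - Real.exp (-((1 + 1 / (⌊r⌋₊ : ℝ)) ^ r))))
      (fun r : ℝ => r * (Real.exp (-1) - Real.exp (-Real.exp 1))) ∧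
    (∃ c' : ℝ, 0 < c' ∧ ∀ᶠ r : ℝ in Filter.atTop,
      ENNReal.ofReal (c' * r) ≤ ⨆ (t : ℝ) (_ : 0 ≤ t), traceClassNorm (heatHankel r t)) := by
  have hlower : ∀ r : ℝ, 1 ≤ r → _ := fun r hr =>
    le_traceClassNorm_heatHankel r ⌊r⌋₊ (Nat.floor_pos.2 hr).ne'
  refine ⟨?_, hlower, isEquivalent_floor_mul, ?_⟩
  · obtain ⟨C, hC, h⟩ := exists_iSup_traceClassNorm_le
    refine ⟨C + 9, by linarith, fun r hr => ⟨fun β hβ => ?_, ?_⟩⟩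
    · have hmin : 0 < min r 1 := lt_min hr one_pos
      have hmin' := min_le_left r 1
      have h0 : -r ≤ 2 * β := by rcases hβ with rfl | rfl <;> linarith
      have h1 : 2 * β ≤ r := by rcases hβ with rfl | rfl <;> linarith
      refine ⟨(eLpNorm_deriv_exp_neg_rpow_le hr h0 h1).trans (ENNReal.ofReal_le_ofReal ?_),
        (eLpNorm_deriv_deriv_exp_neg_rpow_le hr h0 h1).trans (ENNReal.ofReal_le_ofReal ?_)⟩ <;>
      · gcongr
        linarith
    · refine (h r hr).trans (ENNReal.ofReal_le_ofReal ?_)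
      gcongr
      linarith
  · have hK := exp_neg_one_sub_pos
    refine ⟨(Real.exp (-1) - Real.exp (-Real.exp 1)) / 2, by linarith, ?_⟩
    -- The ratio φ tends to 1, hence eventually exceeds 1/2, the factor lost in c'.
    obtain ⟨φ, hφ, he⟩ := isEquivalent_floor_mul.exists_eq_mul
    filter_upwards [he, hφ.eventually (lt_mem_nhds (by norm_num : (1 / 2 : ℝ) < 1)),
      Filter.eventually_ge_atTop 1] with r hr hφr hr1
    refine le_trans (ENNReal.ofReal_le_ofReal ?_) ((hlower r hr1).trans
      (le_iSup₂ (f := fun (t : ℝ) (_ : 0 ≤ t) => traceClassNorm (heatHankel r t))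
        ((⌊r⌋₊ : ℝ) ^ (-r)) (by positivity)))
    rw [hr, Pi.mul_apply]
    have : 0 ≤ r * (Real.exp (-1) - Real.exp (-Real.exp 1)) := by positivity
    nlinarith
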